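/- Let $d\ge 1$, $T>0$, $D=\mathbb{R}^d/\mathbb{Z}^d$, and let $P_0\in L^2(D,\mathbb{R}^d)$ be a divergence-free (in the sense of distributions) vector field of zero mean on $D$. Repeated indices are summed. Let $\mathcal{EB}_{2,\infty}$ be the class of all pairs $(E,B)$ with $E\in L^2([0,T]\times D,\mathbb{R}^d)$ and $B\in L^\infty([0,T]\times D)$ valued in the symmetric $d\times d$ matrices, such that $\partial_tB=LE$ and $B(T,\cdot)=0$, where $$(LE)_{ij}=\tfrac12(\partial_jE_i+\partial_iE_j)+\partial_i\partial_j(-\Delta)^{-1}\partial^kE_k ,$$ in the following weak sense: $$\int_{[0,T]\times D}\Big(B_{ij}(t,x)\,\zeta'(t)\,\psi^{ij}(x)-E_k(t,x)\,\zeta(t)\,\big(\partial_j\psi^{kj}+\partial^k(-\Delta)^{-1}\partial_i\partial_j\psi^{ij}\big)(x)\Big)\,dx\,dt=0$$ for all smooth $\zeta$ on $[0,T]$ with $\zeta(0)=0$ and all smooth $\psi$ on $D$ valued in the symmetric $d\times d$ matrices. Here $(-\Delta)^{-1}f$ is the smooth zero-mean solution $\theta$ on $D$ of $-\Delta\theta=f$.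 For $(E,B)\in\mathcal{EB}_{2,\infty}$ let $$K[E,B]=\sup_{(Z,M)}\ \frac12\int_{[0,T]\times D}\Big(2E_iZ^i-(\delta_{ij}+2B_{ij})M^{ij}\Big)\,dx\,dt\ \in[0,+\infty],$$ the supremum being over all continuous $Z:[0,T]\times D\to\mathbb{R}^d$ and all continuous symmetric-matrix-valued $M$ on $[0,T]\times D$ with $M\ge Z\otimes Z$ pointwise; this is the precise meaning of $\frac12\int E\cdot(\mathbb{I}_d+2B)^{-1}\cdot E$. Let $$\mathcal{J}[P_0]=\sup_{(E,B)\in\mathcal{EB}_{2,\infty}}\Big(-K[E,B]-\int_{[0,T]\times D}P_0\cdot E\,dx\,dt\Big).$$ Then this supremum is attained by some $(E,B)\in\mathcal{EB}_{2,\infty}$, and $$0\le\mathcal{J}[P_0]\le Td\int_D|P_0|^2 .$$ Moreover every maximizer $(E,B)$ satisfies $\mathrm{spec}(B)\subset[-\tfrac12,\tfrac{d-1}2]$ a.e. in $[0,T]\times D$, $$\int_{[0,T]\times D}|E|^2\le 4d^2T\int_D|P_0|^2,$$ and $B\in C^{1/2}([0,T],C^1(D)'_{w*})$: there are bounded linear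 functionals $b(t)$, $t\in[0,T]$, on the space of $C^1$ symmetric-matrix-valued fields on $D$, such that for a.e. $t$ one has $\langle b(t),\psi\rangle=\int_DB_{ij}(t,x)\psi^{ij}(x)\,dx$ for all $\psi$, and such that for some constant $C$ (independent of $\psi,s,t$) $$|\langle b(t),\psi\rangle-\langle b(s),\psi\rangle|\le C\,\|\psi\|_{C^1}\,|t-s|^{1/2}\qquad\text{for all }\psi\text{ and all }s,t\in[0,T].$$ -/

import Mathlib

open scoped ContDiff
open MeasureTheory Set

noncomputable section

namespace EulerDual

/-- The periodic box `D = ℝ^d / ℤ^d`. -/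
abbrev Torus (d : ℕ) : Type := UnitAddTorus (Fin d)

/-- Vectors in `ℝ^d` with the Euclidean norm. -/
abbrev Vec (d : ℕ) : Type := EuclideanSpace ℝ (Fin d)

/-- Real `d × d` matrices. -/
abbrev Mat (d : ℕ) : Type := Matrix (Fin d) (Fin d) ℝ

/-- `f : D → ℝ` is of class `C^n`: its `ℤ^d`-periodic lift to `ℝ^d` is. -/
def TorusContDiff {d : ℕ} (n : WithTop ℕ∞) (f : Torus d → ℝ) : Prop :=
  ContDiff ℝ n (fun x : Fin d → ℝ => f (fun i => ((x i : ℝ) : UnitAddCircle)))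

/-- The partial derivative `∂_i f` of a function on `D`. -/
def torusPartial {d : ℕ} (i : Fin d) (f : Torus d → ℝ) (x : Torus d) : ℝ :=
  deriv (fun s : ℝ => f (x + Pi.single i ((s : ℝ) : UnitAddCircle))) 0

/-- `θ = (-Δ)⁻¹ f`: `θ` is the smooth function of zero mean on `D` with `-Δ θ = f`. -/
def IsInvNegLaplacian {d : ℕ} (θ f : Torus d → ℝ) : Prop :=
  TorusContDiff ∞ θ ∧ ∫ x, θ x = 0 ∧
    ∀ x, -(∑ i, torusPartial i (torusPartial i θ) x) = f x

/-- `div P = 0` on `D`, in the sense of distributions. -/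
def IsDivFree {d : ℕ} (P : Torus d → Vec d) : Prop :=
  ∀ φ : Torus d → ℝ, TorusContDiff ∞ φ → ∫ x, ∑ i, torusPartial i φ x * P x i = 0

/-- The measure `dt dx` on `[0,T] × D`, as a measure on `ℝ × D`. -/
def spaceTime (d : ℕ) (T : ℝ) : Measure (ℝ × Torus d) :=
  (volume.restrict (Icc 0 T)).prod volume

/-- The weak form of `∂_t B = L E`, `B(T,·) = 0`, where
`(L E)_{ij} = (∂_j E_i + ∂_i E_j) / 2 + ∂_i ∂_j (-Δ)⁻¹ ∂^k E_k`.
The test functions are `ζ(t) ψ(x)`, with `ζ(0) = 0` and `ψ` symmetric, and the (formal) adjoint is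
`(L* ψ)^k = -(∂_j ψ^{kj} + ∂^k (-Δ)⁻¹ ∂_i ∂_j ψ^{ij})`.
Below `θ = (-Δ)⁻¹ ∂_i ∂_j ψ^{ij}`. -/
def WeakConstraint {d : ℕ} (T : ℝ) (E : ℝ × Torus d → Vec d) (B : ℝ × Torus d → Mat d) : Prop :=
  ∀ (ζ : ℝ → ℝ) (ψ : Torus d → Mat d) (θ : Torus d → ℝ),
    ContDiff ℝ ∞ ζ → ζ 0 = 0 →
    (∀ x, (ψ x).IsSymm) → (∀ i j, TorusContDiff ∞ (fun x => ψ x i j)) →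
    IsInvNegLaplacian θ
      (fun x => ∑ i, ∑ j, torusPartial i (torusPartial j (fun y => ψ y i j)) x) →
    ∫ p, ((∑ i, ∑ j, B p i j * (deriv ζ p.1 * ψ p.2 i j))
        - ∑ k, E p k * (ζ p.1 *
            ((∑ j, torusPartial j (fun y => ψ y k j) p.2) + torusPartial k θ p.2)))
      ∂(spaceTime d T) = 0

/-- The class `EB_{2,∞}` of fields `(E,B) ∈ L² × L^∞` on `[0,T] × D`, with values in `ℝ^d` and in the
symmetric `d × d` matrices, such that `∂_t B = L E` and `B(T,·) = 0` weakly. -/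
structure MemEB {d : ℕ} (T : ℝ) (E : ℝ × Torus d → Vec d) (B : ℝ × Torus d → Mat d) : Prop where
  memLp_E : MemLp E 2 (spaceTime d T)
  memLp_B : ∀ i j, MemLp (fun p => B p i j) ⊤ (spaceTime d T)
  symm_B : ∀ᵐ p ∂(spaceTime d T), (B p).IsSymm
  weak : WeakConstraint T E B

/-- Continuous pairs `(Z,M)` on `[0,T] × D`, with `M` symmetric and `M ≥ Z ⊗ Z` pointwise. -/
structure IsDualPair {d : ℕ} (T : ℝ) (Z : ℝ × Torus d → Vec d) (M : ℝ × Torus d → Mat d) :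
    Prop where
  continuousOn_Z : ContinuousOn Z (Icc 0 T ×ˢ univ)
  continuousOn_M : ContinuousOn M (Icc 0 T ×ˢ univ)
  symm_M : ∀ p ∈ Icc 0 T ×ˢ (univ : Set (Torus d)), (M p).IsSymm
  le_M : ∀ p ∈ Icc 0 T ×ˢ (univ : Set (Torus d)),
    (M p - Matrix.vecMulVec (fun i => Z p i) (fun i => Z p i)).PosSemidef

/-- `K[E,B] = ½ ∫ E · (I + 2B)⁻¹ · E`, in its precise form
`sup_{M ≥ Z ⊗ Z} ½ ∫ (2 E_i Z^i - (δ_{ij} + 2 B_{ij}) M^{ij}) ∈ [0,+∞]`. -/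
def K {d : ℕ} (T : ℝ) (E : ℝ × Torus d → Vec d) (B : ℝ × Torus d → Mat d) : EReal :=
  ⨆ (Z : ℝ × Torus d → Vec d) (M : ℝ × Torus d → Mat d) (_ : IsDualPair T Z M),
    (((1 / 2 : ℝ) * ∫ p, (2 * (∑ i, E p i * Z p i)
        - ∑ i, ∑ j, ((1 : Mat d) i j + 2 * B p i j) * M p i j) ∂(spaceTime d T) : ℝ) : EReal)

/-- The functional `-K[E,B] - ∫ P₀ · E` to be maximized. -/
def objective {d : ℕ} (T : ℝ) (P₀ : Torus d → Vec d)
    (E : ℝ × Torus d → Vec d) (B : ℝ × Torus d → Mat d) : EReal :=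
  -(K T E B) - ((∫ p, ∑ i, P₀ p.2 i * E p i ∂(spaceTime d T) : ℝ) : EReal)

/-- The optimal value `J[P₀]`. -/
def J {d : ℕ} (T : ℝ) (P₀ : Torus d → Vec d) : EReal :=
  ⨆ (E : ℝ × Torus d → Vec d) (B : ℝ × Torus d → Mat d) (_ : MemEB T E B), objective T P₀ E B

/-- `(E,B)` is a solution of the maximization problem. -/
def IsMaximizer {d : ℕ} (T : ℝ) (P₀ : Torus d → Vec d)
    (E : ℝ × Torus d → Vec d) (B : ℝ × Torus d → Mat d) : Prop :=
  MemEB T E B ∧ objective T P₀ E B = J T P₀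

/-- The space `C¹(D)` of symmetric-matrix-valued fields. -/
def C1Sym (d : ℕ) : Submodule ℝ (Torus d → Mat d) where
  carrier := {ψ | (∀ x, (ψ x).IsSymm) ∧ ∀ i j, TorusContDiff 1 (fun x => ψ x i j)}
  add_mem' := fun ha hb =>
    ⟨fun x => (ha.1 x).add (hb.1 x), fun i j => ContDiff.add (ha.2 i j) (hb.2 i j)⟩
  zero_mem' := ⟨fun _ => Matrix.isSymm_zero, fun _ _ => contDiff_const⟩
  smul_mem' := fun c _ ha =>
    ⟨fun x => (ha.1 x).smul c, fun i j => ContDiff.const_smul c (ha.2 i j)⟩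

/-- The `C¹` norm: the sup norm of the entries plus the sup norm of their first derivatives. -/
def c1Norm {d : ℕ} (ψ : C1Sym d) : ℝ :=
  (⨆ q : Torus d × Fin d × Fin d, |ψ.1 q.1 q.2.1 q.2.2|)
    + ⨆ q : Torus d × Fin d × Fin d × Fin d,
        |torusPartial q.2.1 (fun y => ψ.1 y q.2.2.1 q.2.2.2) q.1|

/-- `B ∈ C^{1/2}([0,T], C¹(D)'_{w*})`: there is a curve `b` on `[0,T]` of bounded linear
functionals on `C¹(D)` which for a.e. `t` is integration against `B(t,·)`, and such that
`t ↦ ⟨b(t), ψ⟩` is `1/2`-Hölder for each `ψ ∈ C¹(D)`, with a constant that is at most a fixed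
multiple of the `C¹` norm of `ψ`. -/
def IsHolderHalfWeakStar {d : ℕ} (T : ℝ) (B : ℝ × Torus d → Mat d) : Prop :=
  ∃ b : ℝ → (C1Sym d →ₗ[ℝ] ℝ),
    (∀ t ∈ Icc 0 T, ∃ C : ℝ, ∀ ψ, |b t ψ| ≤ C * c1Norm ψ) ∧
    (∀ᵐ t ∂(volume.restrict (Icc 0 T)), ∀ ψ : C1Sym d,
      b t ψ = ∫ x, ∑ i, ∑ j, B (t, x) i j * ψ.1 x i j) ∧
    ∃ C : ℝ, ∀ ψ, ∀ s ∈ Icc 0 T, ∀ t ∈ Icc 0 T,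
      |b t ψ - b s ψ| ≤ C * c1Norm ψ * Real.sqrt |t - s|

end EulerDual

end

noncomputable section

/-! ### Calculus on the torus: lifts, partial derivatives, integration by parts. -/

namespace EulerDual

variable {d : ℕ}

/-! Everything rests on a pointwise bound hidden in the constraint. Testing `∂_t B = L E` with `ψ =
f I` gives `L*ψ = 0`, because `div (f I) = ∇f` is a gradient; hence `tr B = 0` a.e.
(`ae_trace_eq_zero`). If `K[E,B]` is finite, testing with `Z = 0` and `M` a large multiple of `φ v ⊗
v` forces `I + 2B ≥ 0` (`MemEBTwo.ae_posSemidef`). A nonnegative matrix of trace `d` lies between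
`0` and `d I`, so the spectrum of `B` lies in `[-1/2, (d-1)/2]` and `B` is bounded, even if it was
only assumed square integrable.

The upper bound `I + 2B ≤ d I` also makes `K` coercive: `M = Z ⊗ Z` with `Z` close to `E/d` gives
`∫|E|² ≤ 2d K` (`MemEBTwo.integral_norm_sq_le`). Write `e` for the `L²` norm of `E` and `q² = T
∫|P₀|²`. If the objective is at least `c`, Cauchy-Schwarz yields `e² ≤ 2d (q e - c)`. All
quantitative claims come from this inequality: the bound on `J`, the bound on the `E` of a maximizer
(`c = 0`, since the zero pair has nonnegative objective), and the boundedness of superlevel sets.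

For existence, `K` is a supremum of functions affine in `(E,B)` and the constraint is linear. In the
Hilbert space of square integrable pairs, superlevel sets are therefore closed and convex, and they
are bounded by the above. Nested nonempty sets of this kind have a common point
(`exists_forall_mem_of_antitone_convex`), and a point common to the levels `J - 1/(n+1)` is a
maximizer.

For the time regularity, `L*ψ` is minus the Leray projection of `div ψ`, so it extends from smooth
to `C¹` fields with values in `L²`. Integrating the constraint from `t` to `T` gives `⟨B(t),ψ⟩ =
∫_t^T ∫ E · leray (div ψ)`, whose right side makes sense for every `t` and is `1/2`-Hölder by
Cauchy-Schwarz. The delicate point is a null set of times independent of `ψ` (`ae_evolution`): the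
identity is obtained for the countably many Fourier modes, where `(-Δ)⁻¹` is explicit, and extended
by `L²` continuity. -/

/-- The covering map `ℝ^d → D`. -/
def torusProj (y : Fin d → ℝ) : Torus d := fun i => ((y i : ℝ) : UnitAddCircle)

theorem isOpenQuotientMap_torusProj : IsOpenQuotientMap (torusProj (d := d)) :=
  IsOpenQuotientMap.piMap (f := fun (_ : Fin d) (s : ℝ) => (s : UnitAddCircle))
    (fun _ => QuotientAddGroup.isOpenQuotientMap_mk)

theorem torusProj_add_single (y : Fin d → ℝ) (i : Fin d) (s : ℝ) :
    torusProj y + Pi.single i ((s : ℝ) : UnitAddCircle) = torusProj (y + s • Pi.single i 1) := by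
  ext k
  by_cases h : k = i
  · subst h
    simp [torusProj]
  · simp [torusProj, h]

theorem TorusContDiff.lift {n : WithTop ℕ∞} {f : Torus d → ℝ} (hf : TorusContDiff n f) :
    ContDiff ℝ n (fun y => f (torusProj y)) := hf

theorem TorusContDiff.continuous {n : WithTop ℕ∞} {f : Torus d → ℝ} (hf : TorusContDiff n f) :
    Continuous f :=
  isOpenQuotientMap_torusProj.isQuotientMap.continuous_iff.2 hf.lift.continuous

theorem TorusContDiff.of_le {n m : WithTop ℕ∞} {f : Torus d → ℝ} (hf : TorusContDiff n f)
    (h : m ≤ n) : TorusContDiff m f := ContDiff.of_le hf h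

theorem TorusContDiff.hasDerivAt_zero {f : Torus d → ℝ} (hf : TorusContDiff 1 f) (y : Fin d → ℝ)
    (i : Fin d) :
    HasDerivAt (fun s : ℝ => f (torusProj y + Pi.single i ((s : ℝ) : UnitAddCircle)))
      (fderiv ℝ (fun y => f (torusProj y)) y (Pi.single i 1)) 0 := by
  simp only [torusProj_add_single]
  have h1 : HasFDerivAt (fun y => f (torusProj y)) (fderiv ℝ (fun y => f (torusProj y)) y)
      (y + (0 : ℝ) • Pi.single i 1) := by
    simpa using (hf.lift.differentiable (by simp) y).hasFDerivAt
  have h2 : HasDerivAt (fun s : ℝ => y + s • (Pi.single i 1 : Fin d → ℝ)) (Pi.single i 1) 0 := by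
    simpa using ((hasDerivAt_id (0 : ℝ)).smul_const (Pi.single i 1 : Fin d → ℝ)).const_add y
  exact h1.comp_hasDerivAt (0 : ℝ) h2

theorem TorusContDiff.torusPartial_proj {f : Torus d → ℝ} (hf : TorusContDiff 1 f) (i : Fin d)
    (y : Fin d → ℝ) :
    torusPartial i f (torusProj y) = fderiv ℝ (fun y => f (torusProj y)) y (Pi.single i 1) :=
  (hf.hasDerivAt_zero y i).deriv

theorem TorusContDiff.hasDerivAt {f : Torus d → ℝ} (hf : TorusContDiff 1 f) (i : Fin d)
    (x : Torus d) (s : ℝ) :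
    HasDerivAt (fun s : ℝ => f (x + Pi.single i ((s : ℝ) : UnitAddCircle)))
      (torusPartial i f (x + Pi.single i ((s : ℝ) : UnitAddCircle))) s := by
  obtain ⟨y, hy⟩ := isOpenQuotientMap_torusProj.surjective (x + Pi.single i ((s : ℝ) : UnitAddCircle))
  have h := hf.hasDerivAt_zero y i
  rw [← hf.torusPartial_proj, hy, ← sub_self s] at h
  have h3 := h.comp_sub_const s s
  have e : (fun u : ℝ => f (x + Pi.single i ((u : ℝ) : UnitAddCircle))) = fun u : ℝ =>
      f (x + Pi.single i ((s : ℝ) : UnitAddCircle) + Pi.single i ((u - s : ℝ) : UnitAddCircle)) := by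
    funext u
    rw [add_assoc, ← Pi.single_add, ← AddCircle.coe_add, add_sub_cancel]
  rw [e]
  exact h3

theorem TorusContDiff.torusPartial {n m : WithTop ℕ∞} {f : Torus d → ℝ} (hf : TorusContDiff n f)
    (i : Fin d) (h : m + 1 ≤ n) : TorusContDiff m (torusPartial i f) := by
  have h1 : TorusContDiff 1 f := hf.of_le (le_trans (by simp) h)
  have : (fun y => EulerDual.torusPartial i f (torusProj y)) =
      fun y => fderiv ℝ (fun y => f (torusProj y)) y (Pi.single i 1) :=
    funext (h1.torusPartial_proj i)
  change ContDiff ℝ m (fun y => EulerDual.torusPartial i f (torusProj y))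
  rw [this]
  exact (hf.lift.fderiv_right h).clm_apply contDiff_const

theorem TorusContDiff.continuous_torusPartial {f : Torus d → ℝ} (hf : TorusContDiff 1 f)
    (i : Fin d) : Continuous (EulerDual.torusPartial i f) :=
  (hf.torusPartial (m := 0) i (by simp)).continuous

theorem TorusContDiff.torusPartial_infty {f : Torus d → ℝ} (hf : TorusContDiff ∞ f) (i : Fin d) :
    TorusContDiff ∞ (EulerDual.torusPartial i f) := hf.torusPartial i (by simp)

theorem TorusContDiff.one {f : Torus d → ℝ} (hf : TorusContDiff ∞ f) : TorusContDiff 1 f :=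
  hf.of_le (by simp)

theorem TorusContDiff.add {n : WithTop ℕ∞} {f g : Torus d → ℝ} (hf : TorusContDiff n f)
    (hg : TorusContDiff n g) : TorusContDiff n (fun x => f x + g x) := ContDiff.add hf hg

theorem TorusContDiff.const_mul {n : WithTop ℕ∞} {f : Torus d → ℝ} (hf : TorusContDiff n f)
    (c : ℝ) : TorusContDiff n (fun x => c * f x) := ContDiff.const_smul c hf

theorem TorusContDiff.mul {n : WithTop ℕ∞} {f g : Torus d → ℝ} (hf : TorusContDiff n f)
    (hg : TorusContDiff n g) : TorusContDiff n (fun x => f x * g x) := ContDiff.mul hf hg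

theorem TorusContDiff.hasDerivAt_zero' {f : Torus d → ℝ} (hf : TorusContDiff 1 f) (i : Fin d)
    (x : Torus d) :
    HasDerivAt (fun s : ℝ => f (x + Pi.single i ((s : ℝ) : UnitAddCircle)))
      (EulerDual.torusPartial i f x) 0 := by
  simpa using hf.hasDerivAt i x 0

theorem torusPartial_add {f g : Torus d → ℝ} (hf : TorusContDiff 1 f) (hg : TorusContDiff 1 g)
    (i : Fin d) (x : Torus d) :
    torusPartial i (fun x => f x + g x) x = torusPartial i f x + torusPartial i g x :=
  ((hf.hasDerivAt_zero' i x).add (hg.hasDerivAt_zero' i x)).deriv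

theorem torusPartial_const_mul (f : Torus d → ℝ) (c : ℝ) (i : Fin d) (x : Torus d) :
    torusPartial i (fun x => c * f x) x = c * torusPartial i f x := by
  simp [torusPartial]

theorem torusPartial_mul {f g : Torus d → ℝ} (hf : TorusContDiff 1 f) (hg : TorusContDiff 1 g)
    (i : Fin d) (x : Torus d) :
    torusPartial i (fun x => f x * g x) x = torusPartial i f x * g x + f x * torusPartial i g x := by
  have := ((hf.hasDerivAt_zero' i x).mul (hg.hasDerivAt_zero' i x)).deriv
  simp only [AddCircle.coe_zero, Pi.single_zero, add_zero] at this
  exact this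

theorem integrable_of_continuous {f : Torus d → ℝ} (hf : Continuous f) : Integrable f volume :=
  hf.integrable_of_hasCompactSupport (HasCompactSupport.of_compactSpace f)

theorem exists_abs_le_of_continuous {f : Torus d → ℝ} (hf : Continuous f) :
    ∃ C, ∀ x, |f x| ≤ C := by
  obtain ⟨C, hC⟩ := isCompact_univ.exists_bound_of_continuousOn hf.continuousOn
  exact ⟨C, fun x => hC x (mem_univ x)⟩

theorem integral_add_single (f : Torus d → ℝ) (a : Torus d) :
    ∫ x, f (x + a) = ∫ x, f x := by
  exact integral_add_right_eq_self f _

/-- Differentiation under the integral sign. It is meant for translates `F s`, whose integral is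
constant in `s` by invariance of the measure; it then shows that a derivative on the torus has zero
integral. -/
theorem integral_deriv_eq_zero_of_integral_const {α : Type*} [MeasurableSpace α] {μ : Measure α}
    [IsFiniteMeasure μ] {F F' : ℝ → α → ℝ} {C : ℝ}
    (hF : ∀ s, AEStronglyMeasurable (F s) μ) (hF0 : Integrable (F 0) μ)
    (hF' : AEStronglyMeasurable (F' 0) μ) (hC : ∀ s x, ‖F' s x‖ ≤ C)
    (hd : ∀ s x, HasDerivAt (fun s => F s x) (F' s x) s)
    (hconst : ∀ s, ∫ x, F s x ∂μ = ∫ x, F 0 x ∂μ) : ∫ x, F' 0 x ∂μ = 0 := by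
  have h := (hasDerivAt_integral_of_dominated_loc_of_deriv_le (μ := μ) (F := F) (F' := F')
    (x₀ := 0) (bound := fun _ => C) Filter.univ_mem (Filter.Eventually.of_forall hF) hF0 hF'
    (Filter.Eventually.of_forall fun x s _ => hC s x) (integrable_const C)
    (Filter.Eventually.of_forall fun x s _ => hd s x)).2
  rw [funext hconst] at h
  exact h.unique (hasDerivAt_const _ _)

/-- Translation by `s` in the `i`-th coordinate direction. -/
def torusShift (i : Fin d) (s : ℝ) (x : Torus d) : Torus d :=
  x + Pi.single i ((s : ℝ) : UnitAddCircle)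

theorem continuous_torusShift (i : Fin d) (s : ℝ) : Continuous (torusShift i s) :=
  continuous_id.add continuous_const

theorem integral_torusShift (f : Torus d → ℝ) (i : Fin d) (s : ℝ) :
    ∫ x, f (torusShift i s x) = ∫ x, f x := integral_add_single f _

theorem TorusContDiff.hasDerivAt_torusShift {f : Torus d → ℝ} (hf : TorusContDiff 1 f) (i : Fin d)
    (x : Torus d) (s : ℝ) :
    HasDerivAt (fun s : ℝ => f (torusShift i s x))
      (EulerDual.torusPartial i f (torusShift i s x)) s := hf.hasDerivAt i x s

theorem integral_torusPartial {f : Torus d → ℝ} (hf : TorusContDiff 1 f) (i : Fin d) :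
    ∫ x, torusPartial i f x = 0 := by
  obtain ⟨C, hC⟩ := exists_abs_le_of_continuous (hf.continuous_torusPartial i)
  have hF : ∀ s : ℝ, Continuous fun x : Torus d => f (torusShift i s x) :=
    fun s => hf.continuous.comp (continuous_torusShift i s)
  have hF' : ∀ s : ℝ, Continuous fun x : Torus d => torusPartial i f (torusShift i s x) :=
    fun s => (hf.continuous_torusPartial i).comp (continuous_torusShift i s)
  have h := integral_deriv_eq_zero_of_integral_const (μ := (volume : Measure (Torus d)))
    (F := fun s x => f (torusShift i s x)) (F' := fun s x => torusPartial i f (torusShift i s x))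
    (fun s => (hF s).aestronglyMeasurable) (integrable_of_continuous (hF 0))
    (hF' 0).aestronglyMeasurable (fun s x => hC _) (fun s x => hf.hasDerivAt_torusShift i x s)
    (fun s => by rw [integral_torusShift, integral_torusShift])
  rwa [integral_torusShift] at h

theorem integral_torusPartial_mul {f g : Torus d → ℝ} (hf : TorusContDiff 1 f)
    (hg : TorusContDiff 1 g) (i : Fin d) :
    ∫ x, torusPartial i f x * g x = -∫ x, f x * torusPartial i g x := by
  have h := integral_torusPartial (hf.mul hg) i
  simp only [torusPartial_mul hf hg] at h
  rw [integral_add (f := fun x => torusPartial i f x * g x)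
    (g := fun x => f x * torusPartial i g x) (integrable_of_continuous ((hf.continuous_torusPartial i).mul hg.continuous))
    (integrable_of_continuous (hf.continuous.mul (hg.continuous_torusPartial i)))] at h
  linarith

end EulerDual

/-! ### Real Fourier series in `L²(D)`. -/

namespace EulerDual
variable {d : ℕ}

theorem volume_torus_eq_pi_haar :
    (volume : Measure (Torus d)) = Measure.pi (fun _ => AddCircle.haarAddCircle) := by
  rw [volume_pi]
  congr 1
  funext i
  simp [AddCircle.volume_eq_smul_haarAddCircle]

instance isProbabilityMeasure_torus : IsProbabilityMeasure (volume : Measure (Torus d)) := by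
  rw [volume_torus_eq_pi_haar]
  infer_instance

/-- The type `Lp ℂ 2 μ` depends on `μ`, so the identification of `volume` with the product Haar
measure enters by substitution for a variable measure. -/
theorem hasSum_mFourier_of_eq_haar (μ : Measure (Torus d)) [IsFiniteMeasure μ]
    (h : μ = Measure.pi (fun _ => AddCircle.haarAddCircle)) (f : Lp ℂ 2 μ) :
    HasSum (fun n : Fin d → ℤ => (∫ t, UnitAddTorus.mFourier (-n) t • f t ∂μ) •
      ContinuousMap.toLp (E := ℂ) 2 μ ℂ (UnitAddTorus.mFourier n)) f := by
  subst h
  exact UnitAddTorus.hasSum_mFourier_series_L2 f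

/-- The real part of the exponential monomial of frequency `n`. -/
def cosMode (n : Fin d → ℤ) (x : Torus d) : ℝ := (UnitAddTorus.mFourier n x).re

/-- The imaginary part of the exponential monomial of frequency `n`. -/
def sinMode (n : Fin d → ℤ) (x : Torus d) : ℝ := (UnitAddTorus.mFourier n x).im

theorem mFourier_torusProj (n : Fin d → ℤ) (y : Fin d → ℝ) :
    UnitAddTorus.mFourier n (torusProj y) =
      Complex.exp ((∑ i, 2 * Real.pi * n i * y i : ℝ) * Complex.I) := by
  simp only [UnitAddTorus.mFourier, ContinuousMap.coe_mk, torusProj, fourier_coe_apply]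
  rw [← Complex.exp_sum]
  congr 1
  push_cast
  rw [Finset.sum_mul]
  refine Finset.sum_congr rfl fun i _ => ?_
  ring

theorem cosMode_torusProj (n : Fin d → ℤ) (y : Fin d → ℝ) :
    cosMode n (torusProj y) = Real.cos (∑ i, 2 * Real.pi * n i * y i) := by
  rw [cosMode, mFourier_torusProj, Complex.exp_ofReal_mul_I_re]

theorem sinMode_torusProj (n : Fin d → ℤ) (y : Fin d → ℝ) :
    sinMode n (torusProj y) = Real.sin (∑ i, 2 * Real.pi * n i * y i) := by
  rw [sinMode, mFourier_torusProj, Complex.exp_ofReal_mul_I_im]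

theorem torusContDiff_cosMode (n : Fin d → ℤ) : TorusContDiff ∞ (cosMode n) := by
  change ContDiff ℝ ∞ fun y => cosMode n (torusProj y)
  simp only [cosMode_torusProj]
  fun_prop

theorem torusContDiff_sinMode (n : Fin d → ℤ) : TorusContDiff ∞ (sinMode n) := by
  change ContDiff ℝ ∞ fun y => sinMode n (torusProj y)
  simp only [sinMode_torusProj]
  fun_prop

theorem hasDerivAt_phase (n : Fin d → ℤ) (y : Fin d → ℝ) (j : Fin d) :
    HasDerivAt (fun s : ℝ => ∑ i, 2 * Real.pi * n i * (y + s • (Pi.single j 1 : Fin d → ℝ)) i)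
      (2 * Real.pi * n j) 0 := by
  have h : (fun s : ℝ => ∑ i, 2 * Real.pi * n i * (y + s • (Pi.single j 1 : Fin d → ℝ)) i) =
      fun s : ℝ => (∑ i, 2 * Real.pi * n i * y i) + s * (2 * Real.pi * n j) := by
    funext s
    simp only [Pi.add_apply, Pi.smul_apply, smul_eq_mul, mul_add, Finset.sum_add_distrib]
    congr 1
    rw [Finset.sum_eq_single j]
    · simp; ring
    · intro b _ hb; simp [hb]
    · simp
  rw [h]
  simpa using ((hasDerivAt_id (0 : ℝ)).mul_const (2 * Real.pi * n j)).const_add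
    (∑ i, 2 * Real.pi * n i * y i)

theorem torusPartial_cosMode (n : Fin d → ℤ) (j : Fin d) (x : Torus d) :
    torusPartial j (cosMode n) x = -(2 * Real.pi * n j) * sinMode n x := by
  obtain ⟨y, rfl⟩ := isOpenQuotientMap_torusProj.surjective x
  simp only [torusPartial, torusProj_add_single, cosMode_torusProj, sinMode_torusProj]
  rw [(hasDerivAt_phase n y j).cos.deriv]
  simp
  ring

theorem torusPartial_sinMode (n : Fin d → ℤ) (j : Fin d) (x : Torus d) :
    torusPartial j (sinMode n) x = (2 * Real.pi * n j) * cosMode n x := by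
  obtain ⟨y, rfl⟩ := isOpenQuotientMap_torusProj.surjective x
  simp only [torusPartial, torusProj_add_single, cosMode_torusProj, sinMode_torusProj]
  rw [(hasDerivAt_phase n y j).sin.deriv]
  simp
  ring

theorem memLp_of_continuous {F : Type*} [NormedAddCommGroup F] {f : Torus d → F}
    (hf : Continuous f) (p : ENNReal) : MemLp f p volume :=
  hf.memLp_of_hasCompactSupport (HasCompactSupport.of_compactSpace f)

/-- The class in `L²(D)` of a continuous function. -/
def contLp {F : Type*} [NormedAddCommGroup F] (f : Torus d → F) (hf : Continuous f) :
    Lp F 2 (volume : Measure (Torus d)) :=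
  (memLp_of_continuous hf 2).toLp f

theorem coeFn_contLp {F : Type*} [NormedAddCommGroup F] (f : Torus d → F) (hf : Continuous f) : contLp f hf =ᵐ[volume] f :=
  MemLp.coeFn_toLp _

theorem continuous_cosMode (n : Fin d → ℤ) : Continuous (cosMode n) :=
  (torusContDiff_cosMode n).continuous

theorem continuous_sinMode (n : Fin d → ℤ) : Continuous (sinMode n) :=
  (torusContDiff_sinMode n).continuous

/-- The real Fourier expansion of a square integrable function on `D`. -/
theorem hasSum_modes {f : Torus d → ℝ} (hf : MemLp f 2 volume) :
    HasSum (fun n : Fin d → ℤ =>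
      (∫ x, f x * cosMode n x) • contLp (cosMode n) (continuous_cosMode n)
        + (∫ x, f x * sinMode n x) • contLp (sinMode n) (continuous_sinMode n)) (hf.toLp f) := by
  -- Real part of the complex Fourier series: the coefficient is `a - i b` and the monomial `cos + i
  -- sin`, so each term contributes `a cos + b sin`. The sum runs over all of `ℤ^d`, hence no factor
  -- 2 appears.
  have hF : MemLp (fun x => (f x : ℂ)) 2 volume := hf.ofReal
  have h := (hasSum_mFourier_of_eq_haar volume volume_torus_eq_pi_haar (hF.toLp _)).mapL
    ((Complex.reCLM.compLpL 2 (volume : Measure (Torus d))))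
  have e : Complex.reCLM.compLpL 2 (volume : Measure (Torus d)) (hF.toLp _) = hf.toLp f := by
    ext1
    filter_upwards [Complex.reCLM.coeFn_compLpL (hF.toLp _), hF.coeFn_toLp, hf.coeFn_toLp]
      with x h1 h2 h3
    rw [h1, h2, h3]
    simp
  rw [e] at h
  refine h.congr_fun fun n => ?_
  have i1 : Integrable (fun x => f x * cosMode n x) volume :=
    hf.integrable_mul (memLp_of_continuous (continuous_cosMode n) 2)
  have i2 : Integrable (fun x => f x * sinMode n x) volume :=
    hf.integrable_mul (memLp_of_continuous (continuous_sinMode n) 2)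
  have hc : (∫ t, UnitAddTorus.mFourier (-n) t • (hF.toLp _) t ∂volume) =
      ((∫ x, f x * cosMode n x : ℝ) : ℂ) - (∫ x, f x * sinMode n x : ℝ) * Complex.I := by
    rw [← integral_complex_ofReal, ← integral_complex_ofReal, ← integral_mul_const,
      ← integral_sub i1.ofReal (i2.ofReal.mul_const _)]
    refine integral_congr_ae ?_
    filter_upwards [hF.coeFn_toLp] with x hx
    rw [hx, UnitAddTorus.mFourier_neg]
    apply Complex.ext <;> simp [cosMode, sinMode, mul_comm]
  rw [hc]
  ext1
  filter_upwards [Complex.reCLM.coeFn_compLpL ((((∫ x, f x * cosMode n x : ℝ) : ℂ) -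
      (∫ x, f x * sinMode n x : ℝ) * Complex.I) • ContinuousMap.toLp (E := ℂ) 2 volume ℂ
        (UnitAddTorus.mFourier n)),
    Lp.coeFn_smul (((∫ x, f x * cosMode n x : ℝ) : ℂ) -
      (∫ x, f x * sinMode n x : ℝ) * Complex.I) (ContinuousMap.toLp (E := ℂ) 2 volume ℂ
        (UnitAddTorus.mFourier n)),
    ContinuousMap.coeFn_toLp (𝕜 := ℂ) (p := 2) (volume : Measure (Torus d))
      (UnitAddTorus.mFourier n),
    Lp.coeFn_add ((∫ x, f x * cosMode n x) • contLp (cosMode n) (continuous_cosMode n))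
      ((∫ x, f x * sinMode n x) • contLp (sinMode n) (continuous_sinMode n)),
    Lp.coeFn_smul (∫ x, f x * cosMode n x) (contLp (cosMode n) (continuous_cosMode n)),
    Lp.coeFn_smul (∫ x, f x * sinMode n x) (contLp (sinMode n) (continuous_sinMode n)),
    coeFn_contLp (cosMode n) (continuous_cosMode n),
    coeFn_contLp (sinMode n) (continuous_sinMode n)] with x h1 h2 h3 h4 h5 h6 h7 h8
  rw [h1, h2, h4, Pi.add_apply, h5, h6, Pi.smul_apply, Pi.smul_apply, Pi.smul_apply, h3, h7, h8]
  simp [cosMode, sinMode]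

theorem integral_torusPartial_mul_cosMode {f : Torus d → ℝ} (hf : TorusContDiff 1 f) (j : Fin d)
    (n : Fin d → ℤ) : ∫ x, torusPartial j f x * cosMode n x =
      (2 * Real.pi * n j) * ∫ x, f x * sinMode n x := by
  rw [integral_torusPartial_mul hf (torusContDiff_cosMode n).one, ← integral_const_mul,
    ← integral_neg]
  refine integral_congr_ae (Filter.Eventually.of_forall fun x => ?_)
  simp only [torusPartial_cosMode]
  ring

theorem integral_torusPartial_mul_sinMode {f : Torus d → ℝ} (hf : TorusContDiff 1 f) (j : Fin d)
    (n : Fin d → ℤ) : ∫ x, torusPartial j f x * sinMode n x =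
      -(2 * Real.pi * n j) * ∫ x, f x * cosMode n x := by
  rw [integral_torusPartial_mul hf (torusContDiff_sinMode n).one, ← integral_const_mul,
    ← integral_neg]
  refine integral_congr_ae (Filter.Eventually.of_forall fun x => ?_)
  simp only [torusPartial_sinMode]
  ring

theorem contLp_const_mul {f g : Torus d → ℝ} (hf : Continuous f) (hg : Continuous g) (c : ℝ)
    (h : ∀ x, g x = c * f x) : contLp g hg = c • contLp f hf := by
  ext1
  filter_upwards [coeFn_contLp g hg, coeFn_contLp f hf, Lp.coeFn_smul c (contLp f hf)]
    with x h1 h2 h3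
  rw [h1, h3, Pi.smul_apply, h2, h, smul_eq_mul]

/-- An identity `L₀ f = ∑ⱼ Lⱼ (∂ⱼ f)` between continuous functionals on `L²(D)` holds for all `f` of
class `C¹` as soon as it holds for the trigonometric modes. -/
theorem functional_eq_of_modes (L₀ : Lp ℝ 2 (volume : Measure (Torus d)) →L[ℝ] ℝ)
    (L : Fin d → Lp ℝ 2 (volume : Measure (Torus d)) →L[ℝ] ℝ)
    (hcos : ∀ n, L₀ (contLp (cosMode n) (continuous_cosMode n)) =
      ∑ j, L j (contLp (torusPartial j (cosMode n))
        ((torusContDiff_cosMode n).one.continuous_torusPartial j)))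
    (hsin : ∀ n, L₀ (contLp (sinMode n) (continuous_sinMode n)) =
      ∑ j, L j (contLp (torusPartial j (sinMode n))
        ((torusContDiff_sinMode n).one.continuous_torusPartial j)))
    {f : Torus d → ℝ} (hf : TorusContDiff 1 f) :
    L₀ (contLp f hf.continuous) =
      ∑ j, L j (contLp (torusPartial j f) (hf.continuous_torusPartial j)) := by
  have h0 := (hasSum_modes (memLp_of_continuous hf.continuous 2)).mapL L₀
  have h1 := hasSum_sum (s := Finset.univ) fun j (_ : j ∈ Finset.univ) =>
    (hasSum_modes (memLp_of_continuous (hf.continuous_torusPartial j) 2)).mapL (L j)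
  -- The two series agree mode by mode: the factor `2π n_j` that differentiation puts on a mode is
  -- the one integration by parts puts on the coefficients of `∂_j f`, with the same exchange of
  -- cosine and sine.
  refine h0.unique (h1.congr_fun fun n => ?_)
  have e1 : ∀ j, contLp (torusPartial j (cosMode n))
      ((torusContDiff_cosMode n).one.continuous_torusPartial j) = _ := fun j =>
    contLp_const_mul (continuous_sinMode n) _ _ (torusPartial_cosMode n j)
  have e2 : ∀ j, contLp (torusPartial j (sinMode n))
      ((torusContDiff_sinMode n).one.continuous_torusPartial j) = _ := fun j =>
    contLp_const_mul (continuous_cosMode n) _ _ (torusPartial_sinMode n j)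
  replace hcos := hcos n
  replace hsin := hsin n
  simp only [e1, e2] at hcos hsin
  simp only [map_add, map_smul, smul_eq_mul] at hcos hsin ⊢
  rw [hcos, hsin, Finset.mul_sum, Finset.mul_sum, ← Finset.sum_add_distrib]
  refine Finset.sum_congr rfl fun j _ => ?_
  rw [integral_torusPartial_mul_cosMode hf, integral_torusPartial_mul_sinMode hf]
  ring

theorem ae_eq_zero_of_modes {f : Torus d → ℝ} (hf : MemLp f 2 volume)
    (hcos : ∀ n, ∫ x, f x * cosMode n x = 0) (hsin : ∀ n, ∫ x, f x * sinMode n x = 0) :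
    f =ᵐ[volume] 0 := by
  have h := hasSum_modes hf
  simp only [hcos, hsin, zero_smul, add_zero] at h
  have h2 := h.unique hasSum_zero
  exact hf.coeFn_toLp.symm.trans (h2 ▸ Lp.coeFn_zero _ _ _)

end EulerDual

/-! ### The Leray projector and the adjoint operator `L*`. -/

namespace EulerDual
variable {d : ℕ}

theorem continuous_vec {X : Type*} [TopologicalSpace X] {f : X → Fin d → ℝ}
    (hf : ∀ k, Continuous fun x => f x k) : Continuous fun x => (WithLp.toLp 2 (f x) : Vec d) :=
  (PiLp.continuous_toLp 2 _).comp (continuous_pi hf)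

theorem vec_inner_eq_sum (u w : Vec d) : inner ℝ u w = ∑ k, u k * w k := by
  simp [PiLp.inner_apply, mul_comm]

theorem inner_contLp {F : Type*} [NormedAddCommGroup F] [InnerProductSpace ℝ F]
    {u w : Torus d → F} (hu : Continuous u) (hw : Continuous w) :
    inner ℝ (contLp u hu) (contLp w hw) = ∫ x, inner ℝ (u x) (w x) := by
  rw [L2.inner_def]
  refine integral_congr_ae ?_
  filter_upwards [coeFn_contLp u hu, coeFn_contLp w hw] with x h1 h2
  rw [h1, h2]

/-- The gradient of a function on `D`. -/
def torusGrad (f : Torus d → ℝ) (x : Torus d) : Vec d :=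
  WithLp.toLp 2 fun k => torusPartial k f x

theorem TorusContDiff.continuous_torusGrad {f : Torus d → ℝ} (hf : TorusContDiff 1 f) :
    Continuous (torusGrad f) :=
  continuous_vec fun k => hf.continuous_torusPartial k

/-- The space of smooth gradients in `L²(D, ℝ^d)`. -/
def gradSpan (d : ℕ) : Submodule ℝ (Lp (Vec d) 2 (volume : Measure (Torus d))) :=
  Submodule.span ℝ {g | ∃ (f : Torus d → ℝ) (hf : TorusContDiff ∞ f),
    g = contLp (torusGrad f) hf.one.continuous_torusGrad}

instance hasOrthogonalProjection_gradSpan : ((gradSpan d)ᗮ).HasOrthogonalProjection :=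
  haveI : CompleteSpace (gradSpan d)ᗮ := (gradSpan d).isClosed_orthogonal.completeSpace_coe
  Submodule.HasOrthogonalProjection.ofCompleteSpace _

/-- The Leray projector: the orthogonal projection on the divergence-free fields. -/
def leray (d : ℕ) : Lp (Vec d) 2 (volume : Measure (Torus d)) →L[ℝ]
    Lp (Vec d) 2 (volume : Measure (Torus d)) :=
  (gradSpan d)ᗮ.starProjection

theorem norm_leray_le (v : Lp (Vec d) 2 (volume : Measure (Torus d))) : ‖leray d v‖ ≤ ‖v‖ := by
  have h := (leray d).le_of_opNorm_le (Submodule.starProjection_norm_le _) v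
  simpa using h

theorem leray_torusGrad {f : Torus d → ℝ} (hf : TorusContDiff ∞ f) :
    leray d (contLp (torusGrad f) hf.one.continuous_torusGrad) = 0 := by
  rw [leray, Submodule.starProjection_apply_eq_zero_iff]
  exact Submodule.le_orthogonal_orthogonal _ (Submodule.subset_span ⟨f, hf, rfl⟩)

theorem contLp_mem_orthogonal {g : Torus d → Vec d} (hg : Continuous g)
    (hg1 : ∀ k, TorusContDiff 1 fun x => g x k)
    (h : ∀ x, ∑ k, torusPartial k (fun y => g y k) x = 0) : contLp g hg ∈ (gradSpan d)ᗮ := by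
  rw [gradSpan, Submodule.mem_orthogonal]
  intro u hu
  refine Submodule.span_induction (p := fun u _ => inner ℝ u (contLp g hg) = 0)
    ?_ (by simp) ?_ ?_ hu
  · rintro _ ⟨f, hf, rfl⟩
    rw [inner_contLp]
    simp only [vec_inner_eq_sum, torusGrad]
    rw [integral_finsetSum (f := fun k x => torusPartial k f x * g x k) _ fun k _ =>
      integrable_of_continuous ((hf.one.continuous_torusPartial k).mul (hg1 k).continuous)]
    simp only [fun k => integral_torusPartial_mul hf.one (hg1 k) k]
    rw [Finset.sum_neg_distrib, ← integral_finsetSum (f := fun k x => f x * torusPartial k (fun y => g y k) x) _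
      fun k _ => integrable_of_continuous (hf.one.continuous.mul ((hg1 k).continuous_torusPartial k))]
    simp [← Finset.mul_sum, h]
  · intro x y _ _ hx hy
    rw [inner_add_left, hx, hy, add_zero]
  · intro a x _ hx
    rw [inner_smul_left, hx, mul_zero]

theorem contLp_add {F : Type*} [NormedAddCommGroup F] {u w : Torus d → F} (hu : Continuous u)
    (hw : Continuous w) : contLp (u + w) (hu.add hw) = contLp u hu + contLp w hw := rfl

/-- Helmholtz decomposition `v = (v + ∇θ) - ∇θ`: the equation for `θ` says exactly that the first
summand is divergence-free, and the second is a gradient. -/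
theorem leray_eq_add_torusGrad {v : Torus d → Vec d} (hv : Continuous v)
    (hv1 : ∀ k, TorusContDiff 1 fun x => v x k) {θ : Torus d → ℝ} (hθ : TorusContDiff ∞ θ)
    (h : ∀ x, -(∑ k, torusPartial k (torusPartial k θ) x) =
      ∑ k, torusPartial k (fun y => v y k) x) :
    leray d (contLp v hv) = contLp (v + torusGrad θ) (hv.add hθ.one.continuous_torusGrad) := by
  refine Submodule.eq_starProjection_of_mem_orthogonal' (z := -contLp (torusGrad θ)
    hθ.one.continuous_torusGrad) ?_ ?_ ?_
  · refine contLp_mem_orthogonal _ (fun k => (hv1 k).add (hθ.torusPartial_infty k).one) fun x => ?_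
    have e : ∀ k, torusPartial k (fun y => (v + torusGrad θ) y k) x =
        torusPartial k (fun y => v y k) x + torusPartial k (torusPartial k θ) x := fun k =>
      torusPartial_add (hv1 k) (hθ.torusPartial_infty k).one k x
    simp only [e]
    rw [Finset.sum_add_distrib, ← h x, neg_add_cancel]
  · exact neg_mem (Submodule.le_orthogonal_orthogonal _ (Submodule.subset_span ⟨θ, hθ, rfl⟩))
  · rw [contLp_add hv hθ.one.continuous_torusGrad]
    abel

/-- The divergence `∂_j ψ^{kj}` of a matrix field. -/
def matDiv (ψ : Torus d → Mat d) (x : Torus d) : Vec d :=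
  WithLp.toLp 2 fun k => ∑ j, torusPartial j (fun y => ψ y k j) x

theorem continuous_matDiv {ψ : Torus d → Mat d} (hψ : ∀ i j, TorusContDiff 1 fun x => ψ x i j) :
    Continuous (matDiv ψ) :=
  continuous_vec fun k => continuous_finsetSum _ fun j _ => (hψ k j).continuous_torusPartial j

theorem TorusContDiff.sum {ι : Type*} {n : WithTop ℕ∞} {s : Finset ι} {f : ι → Torus d → ℝ}
    (hf : ∀ i ∈ s, TorusContDiff n (f i)) : TorusContDiff n fun x => ∑ i ∈ s, f i x :=
  ContDiff.sum hf

theorem torusPartial_sum {ι : Type*} {s : Finset ι} {f : ι → Torus d → ℝ}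
    (hf : ∀ i ∈ s, TorusContDiff 1 (f i)) (k : Fin d) (x : Torus d) :
    torusPartial k (fun x => ∑ i ∈ s, f i x) x = ∑ i ∈ s, torusPartial k (f i) x :=
  (HasDerivAt.fun_sum fun i hi => (hf i hi).hasDerivAt_zero' k x).deriv

/-- This identifies `-L*ψ` with a projection of `div ψ`. The projected form no longer involves `θ`
and is bounded on `L²`, so it survives for `ψ` merely `C¹`. -/
theorem leray_matDiv {ψ : Torus d → Mat d} (hψ : ∀ i j, TorusContDiff ∞ fun x => ψ x i j)
    {θ : Torus d → ℝ} (hθ : IsInvNegLaplacian θ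
      (fun x => ∑ i, ∑ j, torusPartial i (torusPartial j (fun y => ψ y i j)) x)) :
    leray d (contLp (matDiv ψ) (continuous_matDiv fun i j => (hψ i j).one)) =
      contLp (matDiv ψ + torusGrad θ)
        ((continuous_matDiv fun i j => (hψ i j).one).add hθ.1.one.continuous_torusGrad) := by
  refine leray_eq_add_torusGrad _ (fun k => ?_) hθ.1 fun x => ?_
  · change TorusContDiff 1 fun x => ∑ j, torusPartial j (fun y => ψ y k j) x
    exact TorusContDiff.sum fun j _ => ((hψ k j).torusPartial_infty j).one
  · rw [hθ.2.2 x]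
    refine Finset.sum_congr rfl fun k _ => ?_
    exact (torusPartial_sum (fun j _ => ((hψ k j).torusPartial_infty j).one) k x).symm

/-- For a mode `φ` of frequency `n` and a constant matrix `S`, the inverse Laplacian of
`∂_i ∂_j (S^{ij} φ)` is `-(n · S n / |n|²) φ`. -/
theorem isInvNegLaplacian_mode {φ : Torus d → ℝ} (hφ : TorusContDiff ∞ φ) (n : Fin d → ℤ)
    (h : ∀ i j x, torusPartial i (torusPartial j φ) x = -((2 * Real.pi) ^ 2 * n i * n j) * φ x)
    (S : Mat d) :
    IsInvNegLaplacian
      (fun x => (-(∑ i, ∑ j, S i j * n i * n j) / ∑ i, (n i : ℝ) ^ 2) * φ x)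
      (fun x => ∑ i, ∑ j, torusPartial i (torusPartial j (fun y => S i j * φ y)) x) := by
  set c : ℝ := -(∑ i, ∑ j, S i j * n i * n j) / ∑ i, (n i : ℝ) ^ 2 with hc
  have e : ∀ (a : ℝ) i j x, torusPartial i (torusPartial j (fun y => a * φ y)) x =
      a * (-((2 * Real.pi) ^ 2 * n i * n j) * φ x) := by
    intro a i j x
    have : torusPartial j (fun y => a * φ y) = fun y => a * torusPartial j φ y :=
      funext fun y => torusPartial_const_mul φ a j y
    rw [this, torusPartial_const_mul, h]
  have hzero : ∑ i, (n i : ℝ) ^ 2 = 0 → ∀ i, (n i : ℝ) = 0 := by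
    intro h0 i
    have := (Finset.sum_eq_zero_iff_of_nonneg (fun i _ => sq_nonneg (n i : ℝ))).1 h0 i
      (Finset.mem_univ i)
    exact pow_eq_zero_iff two_ne_zero |>.1 this
  refine ⟨hφ.const_mul c, ?_, fun x => ?_⟩
  · rw [integral_const_mul]
    by_cases h0 : ∑ i, (n i : ℝ) ^ 2 = 0
    -- For `n = 0` division by zero makes `c = 0`, so the candidate is the zero function, as it
    -- should be.
    · rw [hc, h0, div_zero, zero_mul]
    · have : ∃ i, (n i : ℝ) ≠ 0 := by
        by_contra! hn
        exact h0 (by simp [hn])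
      obtain ⟨i, hi⟩ := this
      -- When `n i ≠ 0`, `φ` is a nonzero multiple of `∂_i ∂_i φ` and so has zero mean.
      have h1 := integral_torusPartial (hφ.torusPartial_infty i).one i
      simp only [h] at h1
      rw [integral_const_mul] at h1
      have h2 : -((2 * Real.pi) ^ 2 * n i * n i) ≠ 0 :=
        neg_ne_zero.2 (mul_ne_zero (mul_ne_zero (by positivity) hi) hi)
      rw [(mul_eq_zero.1 h1).resolve_left h2, mul_zero]
  · simp only [e]
    have h1 : ∑ i, c * (-((2 * Real.pi) ^ 2 * n i * n i) * φ x) =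
        -((2 * Real.pi) ^ 2 * φ x) * (c * ∑ i, (n i : ℝ) ^ 2) := by
      rw [Finset.mul_sum, Finset.mul_sum]
      exact Finset.sum_congr rfl fun i _ => by ring
    have h2 : ∑ i, ∑ j, S i j * (-((2 * Real.pi) ^ 2 * n i * n j) * φ x) =
        -((2 * Real.pi) ^ 2 * φ x) * ∑ i, ∑ j, S i j * n i * n j := by
      simp only [Finset.mul_sum]
      exact Finset.sum_congr rfl fun i _ => Finset.sum_congr rfl fun j _ => by ring
    have h3 : c * ∑ i, (n i : ℝ) ^ 2 = -∑ i, ∑ j, S i j * n i * n j := by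
      by_cases h0 : ∑ i, (n i : ℝ) ^ 2 = 0
      · simp [hzero h0]
      · rw [hc, div_mul_cancel₀ _ h0]
    rw [h1, h2, h3]
    ring

theorem torusPartial_torusPartial_cosMode (n : Fin d → ℤ) (i j : Fin d) (x : Torus d) :
    torusPartial i (torusPartial j (cosMode n)) x =
      -((2 * Real.pi) ^ 2 * n i * n j) * cosMode n x := by
  rw [funext (torusPartial_cosMode n j), torusPartial_const_mul, torusPartial_sinMode]
  ring

theorem torusPartial_torusPartial_sinMode (n : Fin d → ℤ) (i j : Fin d) (x : Torus d) :
    torusPartial i (torusPartial j (sinMode n)) x =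
      -((2 * Real.pi) ^ 2 * n i * n j) * sinMode n x := by
  rw [funext (torusPartial_sinMode n j), torusPartial_const_mul, torusPartial_cosMode]
  ring

end EulerDual

/-! ### The time-integrated action of `E` on fixed fields. -/

namespace EulerDual
variable {d : ℕ} {T : ℝ}

instance isFiniteMeasure_spaceTime : IsFiniteMeasure (spaceTime d T) := by
  unfold spaceTime
  infer_instance

theorem memLp_comp_snd {F : Type*} [NormedAddCommGroup F] {v : Torus d → F} {p : ENNReal}
    (hv : MemLp v p volume) : MemLp (fun q : ℝ × Torus d => v q.2) p (spaceTime d T) :=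
  hv.comp_snd _

theorem ae_spaceTime_of_ae {P : Torus d → Prop} (h : ∀ᵐ x, P x) :
    ∀ᵐ q ∂(spaceTime d T), P q.2 :=
  Measure.quasiMeasurePreserving_snd.ae h

theorem restrict_spaceTime (S : Set ℝ) :
    (spaceTime d T).restrict (S ×ˢ univ) = ((volume.restrict (Icc 0 T)).restrict S).prod volume := by
  rw [spaceTime, ← Measure.prod_restrict, Measure.restrict_univ]

theorem integral_comp_snd_spaceTime (f : Torus d → ℝ) (S : Set ℝ) :
    ∫ q in S ×ˢ univ, f q.2 ∂(spaceTime d T) =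
      (volume.restrict (Icc 0 T)).real S * ∫ x, f x := by
  rw [restrict_spaceTime, integral_fun_snd]
  simp [Measure.real]

theorem norm_toLp_sq {α F : Type*} [MeasurableSpace α] {μ : Measure α} [NormedAddCommGroup F]
    [InnerProductSpace ℝ F] {f : α → F} (hf : MemLp f 2 μ) :
    ‖hf.toLp f‖ ^ 2 = ∫ x, ‖f x‖ ^ 2 ∂μ := by
  rw [← real_inner_self_eq_norm_sq, L2.inner_def]
  refine integral_congr_ae ?_
  filter_upwards [hf.coeFn_toLp] with x hx
  rw [hx, real_inner_self_eq_norm_sq]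

theorem norm_sq_eq_integral {α F : Type*} [MeasurableSpace α] {μ : Measure α}
    [NormedAddCommGroup F] [InnerProductSpace ℝ F] (f : Lp F 2 μ) :
    ‖f‖ ^ 2 = ∫ x, ‖f x‖ ^ 2 ∂μ := by
  rw [← norm_toLp_sq (Lp.memLp f), Lp.toLp_coeFn]

theorem integrable_inner_of_memLp {α F : Type*} [MeasurableSpace α] {μ : Measure α}
    [NormedAddCommGroup F] [InnerProductSpace ℝ F] {f g : α → F} (hf : MemLp f 2 μ)
    (hg : MemLp g 2 μ) : Integrable (fun x => (inner ℝ (f x) (g x) : ℝ)) μ := by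
  refine (L2.integrable_inner (𝕜 := ℝ) (hf.toLp f) (hg.toLp g)).congr ?_
  filter_upwards [hf.coeFn_toLp, hg.coeFn_toLp] with x h1 h2
  rw [h1, h2]

theorem inner_toLp {α F : Type*} [MeasurableSpace α] {μ : Measure α}
    [NormedAddCommGroup F] [InnerProductSpace ℝ F] {f g : α → F} (hf : MemLp f 2 μ)
    (hg : MemLp g 2 μ) : (inner ℝ (hf.toLp f) (hg.toLp g) : ℝ) = ∫ x, inner ℝ (f x) (g x) ∂μ := by
  rw [L2.inner_def]
  refine integral_congr_ae ?_
  filter_upwards [hf.coeFn_toLp, hg.coeFn_toLp] with x h1 h2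
  rw [h1, h2]

theorem abs_integral_inner_le {α F : Type*} [MeasurableSpace α] {μ : Measure α}
    [NormedAddCommGroup F] [InnerProductSpace ℝ F] {f g : α → F} (hf : MemLp f 2 μ)
    (hg : MemLp g 2 μ) :
    |∫ x, inner ℝ (f x) (g x) ∂μ| ≤ √(∫ x, ‖f x‖ ^ 2 ∂μ) * √(∫ x, ‖g x‖ ^ 2 ∂μ) := by
  rw [← inner_toLp hf hg, ← norm_toLp_sq hf, ← norm_toLp_sq hg, Real.sqrt_sq (norm_nonneg _),
    Real.sqrt_sq (norm_nonneg _)]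
  exact abs_real_inner_le_norm _ _

/-- The action of `E` on a time-independent field, over the times in `S`. -/
def flux (T : ℝ) (E : ℝ × Torus d → Vec d) (S : Set ℝ)
    (v : Lp (Vec d) 2 (volume : Measure (Torus d))) : ℝ :=
  ∫ p in S ×ˢ univ, inner ℝ (E p) (v p.2) ∂(spaceTime d T)

variable {E : ℝ × Torus d → Vec d}

theorem integrable_flux (hE : MemLp E 2 (spaceTime d T))
    (v : Lp (Vec d) 2 (volume : Measure (Torus d))) :
    Integrable (fun p => (inner ℝ (E p) (v p.2) : ℝ)) (spaceTime d T) :=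
  integrable_inner_of_memLp hE (memLp_comp_snd (Lp.memLp v))

theorem abs_flux_le (hE : MemLp E 2 (spaceTime d T)) (S : Set ℝ)
    (v : Lp (Vec d) 2 (volume : Measure (Torus d))) :
    |flux T E S v| ≤ √(∫ p, ‖E p‖ ^ 2 ∂(spaceTime d T)) *
      √((volume.restrict (Icc 0 T)).real S) * ‖v‖ := by
  refine (abs_integral_inner_le (hE.restrict _)
    ((memLp_comp_snd (Lp.memLp v)).restrict _)).trans ?_
  rw [integral_comp_snd_spaceTime (fun x => ‖v x‖ ^ 2), ← norm_sq_eq_integral,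
    Real.sqrt_mul' _ (sq_nonneg _), Real.sqrt_sq (norm_nonneg _), ← mul_assoc]
  gcongr
  · exact Filter.Eventually.of_forall fun p => sq_nonneg _
  · exact hE.integrable_norm_pow two_ne_zero
  · exact Measure.restrict_le_self

/-- `flux` as a continuous linear functional. -/
def fluxCLM (hE : MemLp E 2 (spaceTime d T)) (S : Set ℝ) :
    Lp (Vec d) 2 (volume : Measure (Torus d)) →L[ℝ] ℝ :=
  LinearMap.mkContinuous
    { toFun := flux T E S
      map_add' := fun u v => by
        rw [flux, flux, flux, ← integral_add (integrable_flux hE u).restrict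
          (integrable_flux hE v).restrict]
        refine integral_congr_ae (ae_restrict_of_ae ?_)
        filter_upwards [ae_spaceTime_of_ae (Lp.coeFn_add u v)] with p hp
        rw [hp, Pi.add_apply, inner_add_right]
      map_smul' := fun c u => by
        rw [flux, flux, RingHom.id_apply, smul_eq_mul, ← integral_const_mul]
        refine integral_congr_ae (ae_restrict_of_ae ?_)
        filter_upwards [ae_spaceTime_of_ae (Lp.coeFn_smul c u)] with p hp
        rw [hp, Pi.smul_apply, inner_smul_right] }
    (√(∫ p, ‖E p‖ ^ 2 ∂(spaceTime d T)) * √((volume.restrict (Icc 0 T)).real S))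
    (abs_flux_le hE S)

theorem fluxCLM_apply (hE : MemLp E 2 (spaceTime d T)) (S : Set ℝ)
    (v : Lp (Vec d) 2 (volume : Measure (Torus d))) : fluxCLM hE S v = flux T E S v := rfl

theorem flux_sub_flux (hE : MemLp E 2 (spaceTime d T)) {s t : ℝ} (hst : s ≤ t)
    (v : Lp (Vec d) 2 (volume : Measure (Torus d))) :
    flux T E (Ici s) v - flux T E (Ici t) v = flux T E (Ico s t) v := by
  have h : Ici s ×ˢ (univ : Set (Torus d)) = Ico s t ×ˢ univ ∪ Ici t ×ˢ univ := by
    rw [← union_prod, Ico_union_Ici_eq_Ici hst]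
  rw [flux, h, setIntegral_union _ (measurableSet_Ici.prod MeasurableSet.univ)
    (integrable_flux hE v).integrableOn (integrable_flux hE v).integrableOn, flux, flux]
  · ring
  · rw [disjoint_left]
    rintro p ⟨h1, -⟩ ⟨h2, -⟩
    exact absurd h1.2 (not_lt.2 h2)

/-- The difference is the flux over the times between `s` and `t`; Cauchy-Schwarz in space-time
turns the length of that interval into its square root. This is the source of the Hölder exponent.
-/
theorem abs_flux_sub_flux_le (hE : MemLp E 2 (spaceTime d T)) (s t : ℝ)
    (v : Lp (Vec d) 2 (volume : Measure (Torus d))) :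
    |flux T E (Ici t) v - flux T E (Ici s) v| ≤
      √(∫ p, ‖E p‖ ^ 2 ∂(spaceTime d T)) * √|t - s| * ‖v‖ := by
  wlog hst : s ≤ t generalizing s t
  · rw [abs_sub_comm, abs_sub_comm t s]
    exact this t s (le_of_not_ge hst)
  rw [abs_sub_comm, flux_sub_flux hE hst]
  refine (abs_flux_le hE _ v).trans ?_
  gcongr
  rw [abs_of_nonneg (sub_nonneg.2 hst)]
  calc (volume.restrict (Icc 0 T)).real (Ico s t) ≤ volume.real (Ico s t) :=
        ENNReal.toReal_mono (by simp) (Measure.restrict_apply_le _ _)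
    _ = t - s := by simp [hst]

end EulerDual

/-! ### The evolution identity at almost every time, for all `C¹` tests at once. -/

namespace EulerDual
variable {d : ℕ} {T : ℝ}

theorem contDiff_primitive {η : ℝ → ℝ} (hη : ContDiff ℝ ∞ η) :
    ContDiff ℝ ∞ (fun t => ∫ s in (0 : ℝ)..t, η s) ∧
      deriv (fun t => ∫ s in (0 : ℝ)..t, η s) = η := by
  have h : ∀ t, HasDerivAt (fun t => ∫ s in (0 : ℝ)..t, η s) (η t) t := fun t =>
    hη.continuous.integral_hasStrictDerivAt 0 t |>.hasDerivAt
  have h2 : deriv (fun t => ∫ s in (0 : ℝ)..t, η s) = η := funext fun t => (h t).deriv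
  refine ⟨contDiff_infty_iff_deriv.2 ⟨fun t => (h t).differentiableAt, ?_⟩, h2⟩
  rw [h2]
  exact hη

/-- A function `β` on `[0,T]` with `β' = -γ`, `β(T) = 0` weakly is `∫_s^T γ`. -/
theorem ae_eq_integral_of_weak_deriv {β γ : ℝ → ℝ}
    (hβ : Integrable β (volume.restrict (Icc 0 T))) (hγ : Integrable γ (volume.restrict (Icc 0 T)))
    (h : ∀ ζ : ℝ → ℝ, ContDiff ℝ ∞ ζ → ζ 0 = 0 →
      ∫ t in Icc 0 T, deriv ζ t * β t = ∫ t in Icc 0 T, ζ t * γ t) :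
    ∀ᵐ s ∂(volume.restrict (Icc 0 T)),
      β s = ∫ t in Ici s, γ t ∂(volume.restrict (Icc 0 T)) := by
  set ν := volume.restrict (Icc (0 : ℝ) T) with hν
  have hm : MeasurableSet {p : ℝ × ℝ | p.1 ≤ p.2} := measurableSet_le measurable_fst measurable_snd
  have hG : Integrable ({p : ℝ × ℝ | p.1 ≤ p.2}.indicator fun p => γ p.2) (ν.prod ν) :=
    (hγ.comp_snd ν).indicator hm
  have hslice : ∀ s, ∫ t, ({p : ℝ × ℝ | p.1 ≤ p.2}.indicator fun p => γ p.2) (s, t) ∂ν =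
      ∫ t in Ici s, γ t ∂ν := by
    intro s
    rw [← integral_indicator measurableSet_Ici]
    rfl
  have hΓ : Integrable (fun s => ∫ t in Ici s, γ t ∂ν) ν := by
    simpa only [hslice] using hG.integral_prod_left
  refine ae_eq_of_integral_contDiff_smul_eq hβ.locallyIntegrable hΓ.locallyIntegrable
    fun η hη hηc => ?_
  -- The test function is the primitive of `η` vanishing at `0`. Its value at `T` is unrestricted,
  -- and this freedom encodes `β(T) = 0`. The rest is Fubini on the triangle `s ≤ t`.
  obtain ⟨hζ, hζ'⟩ := contDiff_primitive hη
  have h1 := h _ hζ (by simp)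
  rw [hζ'] at h1
  simp only [smul_eq_mul]
  rw [h1]
  obtain ⟨C, hC⟩ := hη.continuous.bounded_above_of_compact_support hηc
  have hint : Integrable (Function.uncurry fun s t => η s *
      ({p : ℝ × ℝ | p.1 ≤ p.2}.indicator fun p => γ p.2) (s, t)) (ν.prod ν) :=
    hG.bdd_mul (c := C) (hη.continuous.comp continuous_fst).aestronglyMeasurable
      (Filter.Eventually.of_forall fun p => hC _)
  have hswap := integral_integral_swap hint
  simp only [integral_const_mul, hslice] at hswap
  rw [hswap]
  refine integral_congr_ae ?_
  filter_upwards [ae_restrict_mem measurableSet_Icc] with t ht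
  have e : ∀ s, η s * ({p : ℝ × ℝ | p.1 ≤ p.2}.indicator fun p => γ p.2) (s, t) =
      (Iic t).indicator η s * γ t := by
    intro s
    by_cases hs : s ≤ t <;> simp [indicator, hs]
  simp only [e]
  rw [integral_mul_const, integral_indicator measurableSet_Iic, hν,
    Measure.restrict_restrict measurableSet_Iic]
  have : Iic t ∩ Icc 0 T = Icc 0 t := by
    ext s
    simp only [mem_inter_iff, mem_Iic, mem_Icc]
    constructor
    · rintro ⟨a, b, c⟩; exact ⟨b, a⟩
    · rintro ⟨a, b⟩; exact ⟨b, a, b.trans ht.2⟩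
  rw [this, intervalIntegral.integral_of_le ht.1, integral_Icc_eq_integral_Ioc]

variable {E : ℝ × Torus d → Vec d} {B : ℝ × Torus d → Mat d}

theorem memLp_continuous_comp_snd {f : Torus d → ℝ} (hf : Continuous f) :
    MemLp (fun p : ℝ × Torus d => f p.2) 2 (spaceTime d T) :=
  memLp_comp_snd (memLp_of_continuous hf 2)

theorem integrable_sum_mul (hB : ∀ i j, MemLp (fun p => B p i j) 2 (spaceTime d T))
    {ψ : Torus d → Mat d} (hψ : ∀ i j, Continuous fun x => ψ x i j) :
    Integrable (fun p => ∑ i, ∑ j, B p i j * ψ p.2 i j) (spaceTime d T) :=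
  integrable_finsetSum _ fun i _ => integrable_finsetSum _ fun j _ =>
    (hB i j).integrable_mul (memLp_continuous_comp_snd (hψ i j))

theorem integrable_time_mul {ζ : ℝ → ℝ} (hζ : Continuous ζ) {f : ℝ × Torus d → ℝ}
    (hf : Integrable f (spaceTime d T)) :
    Integrable (fun p => ζ p.1 * f p) (spaceTime d T) := by
  obtain ⟨C, hC⟩ := isCompact_Icc.exists_bound_of_continuousOn (s := Icc (0 : ℝ) T) hζ.continuousOn
  refine hf.bdd_mul (c := C) (hζ.comp continuous_fst).aestronglyMeasurable ?_
  have : ∀ᵐ t ∂(volume.restrict (Icc (0 : ℝ) T)), ‖ζ t‖ ≤ C := by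
    filter_upwards [ae_restrict_mem measurableSet_Icc] with t ht using hC t ht
  exact Measure.quasiMeasurePreserving_fst.ae this

/-- Fubini reduces the weak constraint to a scalar equation in time. The null set still depends on
`ψ`. -/
theorem ae_weak_evolution (hE : MemLp E 2 (spaceTime d T))
    (hB : ∀ i j, MemLp (fun p => B p i j) 2 (spaceTime d T)) (hw : WeakConstraint T E B)
    {ψ : Torus d → Mat d} (hsymm : ∀ x, (ψ x).IsSymm)
    (hψ : ∀ i j, TorusContDiff ∞ fun x => ψ x i j) {θ : Torus d → ℝ}
    (hθ : IsInvNegLaplacian θ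
      (fun x => ∑ i, ∑ j, torusPartial i (torusPartial j (fun y => ψ y i j)) x)) :
    ∀ᵐ t ∂(volume.restrict (Icc 0 T)), ∫ x, ∑ i, ∑ j, B (t, x) i j * ψ x i j =
      flux T E (Ici t) (leray d (contLp (matDiv ψ) (continuous_matDiv fun i j => (hψ i j).one))) := by
  rw [leray_matDiv hψ hθ]
  have hg := (continuous_matDiv fun i j => (hψ i j).one).add hθ.1.one.continuous_torusGrad
  set g := matDiv ψ + torusGrad θ with hgdef
  have hb := integrable_sum_mul hB fun i j => (hψ i j).continuous
  have he : Integrable (fun p => (inner ℝ (E p) (g p.2) : ℝ)) (spaceTime d T) :=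
    integrable_inner_of_memLp hE (memLp_comp_snd (memLp_of_continuous hg 2))
  have hflux : ∀ t, flux T E (Ici t) (contLp g hg) =
      ∫ s in Ici t, (∫ x : Torus d, inner ℝ (E (s, x)) (g x)) ∂(volume.restrict (Icc 0 T)) := by
    intro t
    have : flux T E (Ici t) (contLp g hg) =
        ∫ p in Ici t ×ˢ univ, inner ℝ (E p) (g p.2) ∂(spaceTime d T) := by
      refine integral_congr_ae (ae_restrict_of_ae ?_)
      filter_upwards [ae_spaceTime_of_ae (coeFn_contLp g hg)] with p hp
      rw [hp]
    rw [this, restrict_spaceTime, integral_prod]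
    have := he.restrict (s := Ici t ×ˢ univ)
    rwa [restrict_spaceTime] at this
  suffices hs : ∀ᵐ t ∂(volume.restrict (Icc 0 T)), ∫ x, ∑ i, ∑ j, B (t, x) i j * ψ x i j =
      ∫ s in Ici t, (∫ x : Torus d, inner ℝ (E (s, x)) (g x)) ∂(volume.restrict (Icc 0 T)) by
    filter_upwards [hs] with t ht
    rw [hflux t]
    exact ht
  refine ae_eq_integral_of_weak_deriv (β := fun t => ∫ x, ∑ i, ∑ j, B (t, x) i j * ψ x i j)
    hb.integral_prod_left he.integral_prod_left fun ζ hζ hζ0 => ?_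
  have h := hw ζ ψ θ hζ hζ0 hsymm hψ hθ
  have e : ∀ p : ℝ × Torus d, ((∑ i, ∑ j, B p i j * (deriv ζ p.1 * ψ p.2 i j))
        - ∑ k, E p k * (ζ p.1 *
            ((∑ j, torusPartial j (fun y => ψ y k j) p.2) + torusPartial k θ p.2))) =
      deriv ζ p.1 * (∑ i, ∑ j, B p i j * ψ p.2 i j) - ζ p.1 * inner ℝ (E p) (g p.2) := by
    intro p
    rw [vec_inner_eq_sum]
    simp only [Finset.mul_sum]
    congr 1
    · exact Finset.sum_congr rfl fun i _ => Finset.sum_congr rfl fun j _ => by ring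
    · refine Finset.sum_congr rfl fun k _ => ?_
      have : g p.2 k = (∑ j, torusPartial j (fun y => ψ y k j) p.2) + torusPartial k θ p.2 := rfl
      rw [this]
      ring
  have hζ'c : Continuous (deriv ζ) := (contDiff_infty_iff_deriv.1 hζ).2.continuous
  simp only [e] at h
  have i1 := integrable_time_mul hζ'c hb
  have i2 := integrable_time_mul hζ.continuous he
  rw [integral_sub i1 i2, sub_eq_zero, spaceTime, integral_prod _ i1, integral_prod _ i2] at h
  simpa only [integral_const_mul] using h


theorem contLp_sum {F ι : Type*} [NormedAddCommGroup F] (s : Finset ι) {u : ι → Torus d → F}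
    (hu : ∀ i, Continuous (u i)) :
    contLp (fun x => ∑ i ∈ s, u i x) (continuous_finsetSum _ fun i _ => hu i) =
      ∑ i ∈ s, contLp (u i) (hu i) := by
  classical
  induction s using Finset.induction_on with
  | empty => simp only [Finset.sum_empty]; rfl
  | insert a s ha ih =>
    rw [Finset.sum_insert ha, ← ih, ← contLp_add]
    simp only [Finset.sum_insert ha]
    rfl

theorem contLp_congr {F : Type*} [NormedAddCommGroup F] {u w : Torus d → F} (hu : Continuous u)
    (h : ∀ x, u x = w x) : contLp u hu = contLp w (funext h ▸ hu) := by
  obtain rfl : u = w := funext h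
  rfl

theorem contLp_const_smul {F : Type*} [NormedAddCommGroup F] [NormedSpace ℝ F] {u : Torus d → F}
    (hu : Continuous u) (c : ℝ) :
    contLp (fun x => c • u x) (hu.const_smul c) = c • contLp u hu := rfl

theorem compLpL_contLp {F G : Type*} [NormedAddCommGroup F] [NormedSpace ℝ F]
    [NormedAddCommGroup G] [NormedSpace ℝ G] (L : F →L[ℝ] G) {u : Torus d → F}
    (hu : Continuous u) :
    L.compLpL 2 volume (contLp u hu) = contLp (fun x => L (u x)) (L.continuous.comp hu) := by
  ext1
  filter_upwards [L.coeFn_compLpL (contLp u hu), coeFn_contLp u hu,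
    coeFn_contLp (fun x => L (u x)) (L.continuous.comp hu)] with x h1 h2 h3
  rw [h1, h2, h3]

theorem ae_memLp_slice {f : ℝ × Torus d → ℝ} (hf : MemLp f 2 (spaceTime d T)) :
    ∀ᵐ t ∂(volume.restrict (Icc 0 T)), MemLp (fun x => f (t, x)) 2 volume := by
  filter_upwards [hf.integrable_sq.prod_right_ae,
    AEStronglyMeasurable.prodMk_left hf.aestronglyMeasurable] with t h1 h2
  exact (memLp_two_iff_integrable_sq h2).2 h1

/-- The matrix `e_i ⊗ e_j + e_j ⊗ e_i`. -/
def symUnit (i j : Fin d) : Mat d :=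
  Matrix.of fun a b => (if a = i ∧ b = j then 1 else 0) + if a = j ∧ b = i then 1 else 0

theorem symUnit_isSymm (i j : Fin d) : (symUnit i j).IsSymm := by
  ext a b
  simp only [symUnit, Matrix.transpose_apply, Matrix.of_apply, and_comm, add_comm]

theorem eq_half_sum_symUnit {M : Mat d} (hM : M.IsSymm) (a b : Fin d) :
    M a b = (1 / 2) * ∑ i, ∑ j, symUnit i j a b * M i j := by
  have h1 : ∑ i, ∑ j, symUnit i j a b * M i j = M a b + M b a := by
    simp only [symUnit, Matrix.of_apply, add_mul, Finset.sum_add_distrib, ite_mul, one_mul,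
      zero_mul, ite_and, Finset.sum_ite_eq, Finset.mem_univ, if_true]
    simp
  rw [h1, hM.apply a b]
  ring

/-- Since `div (S f) = ∑ₖ S_{·k} ∂ₖ f`, the divergence is a sum of bounded operators applied to the
`∂ₖ f`, the form required by `functional_eq_of_modes`. -/
theorem contLp_matDiv_const_mul (S : Mat d) {f : Torus d → ℝ} (hf : TorusContDiff 1 f)
    (h : Continuous (matDiv fun x => Matrix.of fun a b => S a b * f x)) :
    contLp (matDiv fun x => Matrix.of fun a b => S a b * f x) h =
      ∑ k, (ContinuousLinearMap.toSpanSingleton ℝ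
        (WithLp.toLp 2 fun a => S a k : Vec d)).compLpL 2 volume
          (contLp (torusPartial k f) (hf.continuous_torusPartial k)) := by
  simp only [compLpL_contLp]
  rw [← contLp_sum]
  refine contLp_congr _ fun x => ?_
  ext a
  simp [matDiv, torusPartial_const_mul, mul_comm]

/-- One null set serves all `f`: outside the countable union of the null sets of the modes, and of
those where the slice `B(t,·)` is not in `L²`, both sides are continuous functionals on `L²`, of `f`
and of its derivatives respectively. -/
theorem ae_evolution_const_mul (hE : MemLp E 2 (spaceTime d T))
    (hB : ∀ i j, MemLp (fun p => B p i j) 2 (spaceTime d T)) (hw : WeakConstraint T E B)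
    {S : Mat d} (hS : S.IsSymm) :
    ∀ᵐ t ∂(volume.restrict (Icc 0 T)), ∀ (f : Torus d → ℝ) (hf : TorusContDiff 1 f),
      ∫ x, ∑ a, ∑ b, B (t, x) a b * (S a b * f x) =
        flux T E (Ici t) (leray d (contLp (matDiv fun x => Matrix.of fun a b => S a b * f x)
          (continuous_matDiv fun _ _ => hf.const_mul _))) := by
  have hmode : ∀ {φ : Torus d → ℝ} (hφ : TorusContDiff ∞ φ) (n : Fin d → ℤ)
      (_ : ∀ i j x, torusPartial i (torusPartial j φ) x =
        -((2 * Real.pi) ^ 2 * n i * n j) * φ x),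
      ∀ᵐ t ∂(volume.restrict (Icc 0 T)), ∫ x, ∑ a, ∑ b, B (t, x) a b * (S a b * φ x) =
        flux T E (Ici t) (leray d (contLp (matDiv fun x => Matrix.of fun a b => S a b * φ x)
          (continuous_matDiv fun _ _ => hφ.one.const_mul _))) := by
    intro φ hφ n h
    refine ae_weak_evolution hE hB hw (ψ := fun x => Matrix.of fun a b => S a b * φ x)
      (fun x => ?_) (fun i j => hφ.const_mul _) (isInvNegLaplacian_mode hφ n h S)
    ext a b
    simp [hS.apply a b]
  have hc := ae_all_iff.2 fun n => hmode (torusContDiff_cosMode n) n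
    (torusPartial_torusPartial_cosMode n)
  have hs := ae_all_iff.2 fun n => hmode (torusContDiff_sinMode n) n
    (torusPartial_torusPartial_sinMode n)
  have hL := ae_all_iff.2 fun i => ae_all_iff.2 fun j => ae_memLp_slice (hB i j)
  filter_upwards [hc, hs, hL] with t hct hst hLt f hf
  have hh : MemLp (fun x => ∑ a, ∑ b, B (t, x) a b * S a b) 2 volume :=
    memLp_finsetSum _ fun a _ => memLp_finsetSum _ fun b _ => (hLt a b).mul_const _
  have e0 : ∀ {f : Torus d → ℝ} (hf : Continuous f),
      innerSL ℝ (hh.toLp _) (contLp f hf) = ∫ x, ∑ a, ∑ b, B (t, x) a b * (S a b * f x) := by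
    intro f hf
    rw [innerSL_apply_apply, contLp, inner_toLp]
    refine integral_congr_ae (Filter.Eventually.of_forall fun x => ?_)
    simp only [RCLike.inner_apply, conj_trivial, Finset.mul_sum]
    exact Finset.sum_congr rfl fun a _ => Finset.sum_congr rfl fun b _ => by ring
  have e1 : ∀ {f : Torus d → ℝ} (hf : TorusContDiff 1 f),
      ∑ k, ((fluxCLM hE (Ici t)).comp ((leray d).comp ((ContinuousLinearMap.toSpanSingleton ℝ
        (WithLp.toLp 2 fun a => S a k : Vec d)).compLpL 2 volume)))
          (contLp (torusPartial k f) (hf.continuous_torusPartial k)) =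
        flux T E (Ici t) (leray d (contLp (matDiv fun x => Matrix.of fun a b => S a b * f x)
          (continuous_matDiv fun _ _ => hf.const_mul _))) := by
    intro f hf
    rw [contLp_matDiv_const_mul S hf, ← fluxCLM_apply hE, map_sum, map_sum]
    rfl
  rw [← e0 hf.continuous, ← e1 hf]
  refine functional_eq_of_modes _ _ (fun n => ?_) (fun n => ?_) hf
  · rw [e0, e1 (torusContDiff_cosMode n).one]
    exact hct n
  · rw [e0, e1 (torusContDiff_sinMode n).one]
    exact hst n

/-- A symmetric field is half the sum of the `symUnit i j` weighted by its entries, and only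
finitely many constant matrices occur, so the null set stays uniform in `ψ`. -/
theorem ae_evolution (hE : MemLp E 2 (spaceTime d T))
    (hB : ∀ i j, MemLp (fun p => B p i j) 2 (spaceTime d T)) (hw : WeakConstraint T E B) :
    ∀ᵐ t ∂(volume.restrict (Icc 0 T)), ∀ (ψ : Torus d → Mat d) (_ : ∀ x, (ψ x).IsSymm)
      (hψ : ∀ i j, TorusContDiff 1 fun x => ψ x i j),
      ∫ x, ∑ i, ∑ j, B (t, x) i j * ψ x i j =
        flux T E (Ici t) (leray d (contLp (matDiv ψ) (continuous_matDiv hψ))) := by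
  have hS := ae_all_iff.2 fun i => ae_all_iff.2 fun j =>
    ae_evolution_const_mul hE hB hw (symUnit_isSymm i j)
  have hL := ae_all_iff.2 fun i => ae_all_iff.2 fun j => ae_memLp_slice (hB i j)
  filter_upwards [hS, hL] with t hSt hLt ψ hsymm hψ
  have hcont : ∀ i j, Continuous (matDiv fun x => Matrix.of fun a b => symUnit i j a b * ψ x i j) :=
    fun i j => continuous_matDiv fun _ _ => (hψ i j).const_mul _
  have e1 : contLp (matDiv ψ) (continuous_matDiv hψ) = (1 / 2 : ℝ) • ∑ i, ∑ j,
      contLp (matDiv fun x => Matrix.of fun a b => symUnit i j a b * ψ x i j) (hcont i j) := by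
    have h1 : ∀ i, ∑ j, contLp (matDiv fun x => Matrix.of fun a b => symUnit i j a b * ψ x i j)
        (hcont i j) = contLp (fun x => ∑ j, (matDiv fun x => Matrix.of fun a b =>
          symUnit i j a b * ψ x i j) x) (continuous_finsetSum _ fun j _ => hcont i j) :=
      fun i => (contLp_sum _ (hcont i)).symm
    simp only [h1]
    rw [← contLp_sum _ fun i => continuous_finsetSum _ fun j _ => hcont i j, ← contLp_const_smul]
    refine contLp_congr _ fun x => ?_
    ext k
    have h2 : ∀ l, torusPartial l (fun y => ψ y k l) x =
        (1 / 2) * ∑ i, ∑ j, symUnit i j k l * torusPartial l (fun y => ψ y i j) x := by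
      intro l
      have : (fun y => ψ y k l) = fun y => (1 / 2) * ∑ i, ∑ j, symUnit i j k l * ψ y i j :=
        funext fun y => eq_half_sum_symUnit (hsymm y) k l
      rw [this, torusPartial_const_mul, torusPartial_sum fun i _ =>
        TorusContDiff.sum fun j _ => (hψ i j).const_mul _]
      congr 1
      refine Finset.sum_congr rfl fun i _ => ?_
      rw [torusPartial_sum fun j _ => (hψ i j).const_mul _]
      exact Finset.sum_congr rfl fun j _ => torusPartial_const_mul _ _ _ _
    simp only [matDiv, Matrix.of_apply, torusPartial_const_mul, h2, WithLp.ofLp_smul,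
      WithLp.ofLp_sum, Pi.smul_apply, Finset.sum_apply, smul_eq_mul, ← Finset.mul_sum]
    congr 1
    rw [Finset.sum_comm]
    exact Finset.sum_congr rfl fun i _ => Finset.sum_comm
  have e2 : ∫ x, ∑ a, ∑ b, B (t, x) a b * ψ x a b = (1 / 2 : ℝ) * ∑ i, ∑ j,
      ∫ x, ∑ a, ∑ b, B (t, x) a b * (symUnit i j a b * ψ x i j) := by
    have hi : ∀ i j, Integrable (fun x => ∑ a, ∑ b, B (t, x) a b * (symUnit i j a b * ψ x i j))
        volume := fun i j =>
      integrable_finsetSum _ fun a _ => integrable_finsetSum _ fun b _ =>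
        (hLt a b).integrable_mul (memLp_of_continuous ((hψ i j).const_mul _).continuous 2)
    have h1 : ∀ i, ∑ j, ∫ x, ∑ a, ∑ b, B (t, x) a b * (symUnit i j a b * ψ x i j) =
        ∫ x, ∑ j, ∑ a, ∑ b, B (t, x) a b * (symUnit i j a b * ψ x i j) := fun i =>
      (integral_finsetSum _ fun j _ => hi i j).symm
    simp only [h1]
    rw [← integral_finsetSum _ fun i _ => integrable_finsetSum _ fun j _ => hi i j,
      ← integral_const_mul]
    refine integral_congr_ae (Filter.Eventually.of_forall fun x => ?_)
    have h3 : ∀ a b, B (t, x) a b * ψ x a b =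
        (1 / 2) * ∑ i, ∑ j, B (t, x) a b * (symUnit i j a b * ψ x i j) := by
      intro a b
      rw [eq_half_sum_symUnit (hsymm x) a b]
      simp only [Finset.mul_sum]
      exact Finset.sum_congr rfl fun i _ => Finset.sum_congr rfl fun j _ => by ring
    have h4 : ∑ a, ∑ b, B (t, x) a b * ψ x a b =
        (1 / 2) * ∑ a, ∑ b, ∑ i, ∑ j, B (t, x) a b * (symUnit i j a b * ψ x i j) := by
      rw [Finset.mul_sum]
      refine Finset.sum_congr rfl fun a _ => ?_
      rw [Finset.mul_sum]
      exact Finset.sum_congr rfl fun b _ => h3 a b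
    refine h4.trans (congrArg _ ?_)
    calc _ = ∑ a, ∑ i, ∑ b, ∑ j, B (t, x) a b * (symUnit i j a b * ψ x i j) :=
          Finset.sum_congr rfl fun a _ => Finset.sum_comm
      _ = ∑ i, ∑ a, ∑ b, ∑ j, B (t, x) a b * (symUnit i j a b * ψ x i j) := Finset.sum_comm
      _ = ∑ i, ∑ a, ∑ j, ∑ b, B (t, x) a b * (symUnit i j a b * ψ x i j) :=
          Finset.sum_congr rfl fun i _ => Finset.sum_congr rfl fun a _ => Finset.sum_comm
      _ = _ := Finset.sum_congr rfl fun i _ => Finset.sum_comm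
  rw [e1, e2, ← fluxCLM_apply hE, map_smul, map_smul, map_sum, map_sum, smul_eq_mul]
  congr 1
  refine Finset.sum_congr rfl fun i _ => ?_
  rw [map_sum, map_sum]
  exact Finset.sum_congr rfl fun j _ => hSt i j _ (hψ i j)

end EulerDual

/-! ### Vanishing trace and Hölder continuity in time. -/

namespace EulerDual
variable {d : ℕ} {T : ℝ} {E : ℝ × Torus d → Vec d} {B : ℝ × Torus d → Mat d}

/-- Fubini for `f²`. -/
theorem ae_spaceTime_of_slices {f : ℝ × Torus d → ℝ} (hf : MemLp f 2 (spaceTime d T))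
    (h : ∀ᵐ t ∂(volume.restrict (Icc 0 T)), (fun x => f (t, x)) =ᵐ[volume] 0) :
    f =ᵐ[spaceTime d T] 0 := by
  have h0 : ∫ p, f p ^ 2 ∂(spaceTime d T) = 0 := by
    have hi := hf.integrable_sq
    unfold spaceTime at hi ⊢
    rw [integral_prod _ hi]
    refine integral_eq_zero_of_ae ?_
    filter_upwards [h] with t ht
    refine integral_eq_zero_of_ae ?_
    filter_upwards [ht] with x hx
    simp [hx]
  rw [integral_eq_zero_iff_of_nonneg (fun p => sq_nonneg (f p)) hf.integrable_sq] at h0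
  filter_upwards [h0] with p hp
  simpa using hp

theorem matDiv_smul_one (f : Torus d → ℝ) (x : Torus d) :
    matDiv (fun x => f x • (1 : Mat d)) x = torusGrad f x := by
  ext k
  have h : ∀ j, torusPartial j (fun y => (f y • (1 : Mat d)) k j) x =
      if k = j then torusPartial j f x else 0 := by
    intro j
    have : (fun y => (f y • (1 : Mat d)) k j) = fun y => (1 : Mat d) k j * f y := by
      funext y
      simp [mul_comm]
    rw [this, torusPartial_const_mul, Matrix.one_apply]
    split_ifs <;> simp
  simp only [matDiv, torusGrad, h, Finset.sum_ite_eq, Finset.mem_univ, if_true]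

/-- For `ψ = f I` the divergence is `∇f`, which the Leray projector kills; so `tr B(t,·)` is
orthogonal to every mode. -/
theorem ae_trace_eq_zero (hE : MemLp E 2 (spaceTime d T))
    (hB : ∀ i j, MemLp (fun p => B p i j) 2 (spaceTime d T)) (hw : WeakConstraint T E B) :
    ∀ᵐ p ∂(spaceTime d T), ∑ i, B p i i = 0 := by
  refine ae_spaceTime_of_slices (f := fun p => ∑ i, B p i i)
    (memLp_finsetSum _ fun i _ => hB i i) ?_
  filter_upwards [ae_evolution hE hB hw,
    ae_all_iff.2 fun i => ae_all_iff.2 fun j => ae_memLp_slice (hB i j)] with t ht hL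
  have key : ∀ {f : Torus d → ℝ} (_ : TorusContDiff ∞ f),
      ∫ x, (∑ i, B (t, x) i i) * f x = 0 := by
    intro f hf
    have hψ : ∀ i j, TorusContDiff 1 fun x => (f x • (1 : Mat d)) i j := fun i j => by
      have : (fun x => (f x • (1 : Mat d)) i j) = fun x => (1 : Mat d) i j * f x := by
        funext x
        simp [mul_comm]
      rw [this]
      exact hf.one.const_mul _
    have h := ht (fun x => f x • (1 : Mat d)) (fun x => Matrix.isSymm_one.smul _) hψ
    rw [contLp_congr _ (matDiv_smul_one f), leray_torusGrad hf, ← fluxCLM_apply hE, map_zero] at h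
    rw [← h]
    refine integral_congr_ae (Filter.Eventually.of_forall fun x => ?_)
    simp [Matrix.one_apply, Finset.sum_mul]
  exact ae_eq_zero_of_modes (memLp_finsetSum _ fun i _ => hL i i)
    (fun n => key (torusContDiff_cosMode n)) (fun n => key (torusContDiff_sinMode n))

/-- The divergence as a linear map from `C¹` to `L²`. -/
def divLp (d : ℕ) : C1Sym d →ₗ[ℝ] Lp (Vec d) 2 (volume : Measure (Torus d)) where
  toFun ψ := contLp (matDiv ψ.1) (continuous_matDiv ψ.2.2)
  map_add' φ ψ := by
    rw [← contLp_add]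
    refine contLp_congr _ fun x => ?_
    ext k
    have h : ∀ j, torusPartial j (fun y => (φ + ψ : C1Sym d).1 y k j) x =
        torusPartial j (fun y => φ.1 y k j) x + torusPartial j (fun y => ψ.1 y k j) x := fun j =>
      torusPartial_add (φ.2.2 k j) (ψ.2.2 k j) j x
    simp only [matDiv, h, Finset.sum_add_distrib, Pi.add_apply, PiLp.add_apply]
  map_smul' c ψ := by
    rw [RingHom.id_apply, ← contLp_const_smul]
    refine contLp_congr _ fun x => ?_
    ext k
    have h : ∀ j, torusPartial j (fun y => (c • ψ : C1Sym d).1 y k j) x =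
        c * torusPartial j (fun y => ψ.1 y k j) x := fun j =>
      torusPartial_const_mul (fun y => ψ.1 y k j) c j x
    simp only [matDiv, h, Finset.mul_sum, PiLp.smul_apply, smul_eq_mul]

theorem bddAbove_range_of_continuous {ι : Type*} [Finite ι] {f : ι → Torus d → ℝ}
    (hf : ∀ i, Continuous (f i)) : ∃ C, ∀ i x, |f i x| ≤ C := by
  choose C hC using fun i => exists_abs_le_of_continuous (hf i)
  obtain ⟨M, hM⟩ := (Set.finite_range C).bddAbove
  exact ⟨M, fun i x => (hC i x).trans (hM ⟨i, rfl⟩)⟩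

/-- An unbounded real supremum would default to `0`; compactness of the torus provides the bound
that makes `c1Norm` dominate the derivatives. -/
theorem abs_torusPartial_le_c1Norm (ψ : C1Sym d) (x : Torus d) (i k j : Fin d) :
    |torusPartial i (fun y => ψ.1 y k j) x| ≤ c1Norm ψ := by
  obtain ⟨C, hC⟩ := bddAbove_range_of_continuous
    (f := fun (q : Fin d × Fin d × Fin d) => torusPartial q.1 (fun y => ψ.1 y q.2.1 q.2.2))
    fun q => (ψ.2.2 q.2.1 q.2.2).continuous_torusPartial q.1
  have h1 : |torusPartial i (fun y => ψ.1 y k j) x| ≤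
      ⨆ q : Torus d × Fin d × Fin d × Fin d,
        |torusPartial q.2.1 (fun y => ψ.1 y q.2.2.1 q.2.2.2) q.1| :=
    le_ciSup (f := fun q : Torus d × Fin d × Fin d × Fin d =>
      |torusPartial q.2.1 (fun y => ψ.1 y q.2.2.1 q.2.2.2) q.1|)
      ⟨C, by rintro _ ⟨q, rfl⟩; exact hC q.2 q.1⟩ (x, i, k, j)
  exact h1.trans (le_add_of_nonneg_left (Real.iSup_nonneg fun _ => abs_nonneg _))

theorem c1Norm_nonneg (ψ : C1Sym d) : 0 ≤ c1Norm ψ :=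
  add_nonneg (Real.iSup_nonneg fun _ => abs_nonneg _) (Real.iSup_nonneg fun _ => abs_nonneg _)

theorem vec_norm_le_sum (v : Vec d) : ‖v‖ ≤ ∑ k, |v k| := by
  rw [EuclideanSpace.norm_eq]
  refine Real.sqrt_le_iff.2 ⟨Finset.sum_nonneg fun k _ => abs_nonneg _, ?_⟩
  simp only [Real.norm_eq_abs]
  exact Finset.sum_sq_le_sq_sum_of_nonneg fun k _ => abs_nonneg _

theorem norm_divLp_le (ψ : C1Sym d) : ‖divLp d ψ‖ ≤ (d : ℝ) ^ 2 * c1Norm ψ := by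
  have h : ∀ x, ‖matDiv ψ.1 x‖ ≤ (d : ℝ) ^ 2 * c1Norm ψ := by
    intro x
    refine (vec_norm_le_sum _).trans ?_
    calc ∑ k, |∑ j, torusPartial j (fun y => ψ.1 y k j) x| ≤ ∑ _k : Fin d, ∑ _j : Fin d, c1Norm ψ :=
          Finset.sum_le_sum fun k _ => (Finset.abs_sum_le_sum_abs _ _).trans
            (Finset.sum_le_sum fun j _ => abs_torusPartial_le_c1Norm ψ x j k j)
      _ = (d : ℝ) ^ 2 * c1Norm ψ := by simp; ring
  have := Lp.norm_le_of_ae_bound (μ := (volume : Measure (Torus d))) (f := divLp d ψ) (p := 2)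
    (C := (d : ℝ) ^ 2 * c1Norm ψ) (mul_nonneg (sq_nonneg _) (c1Norm_nonneg ψ)) (by
      filter_upwards [coeFn_contLp (matDiv ψ.1) (continuous_matDiv ψ.2.2)] with x hx
      exact hx ▸ h x)
  -- The torus has total mass one, so the uniform bound is also the `L²` bound.
  simpa [measureUnivNNReal] using this

theorem isHolderHalfWeakStar (hE : MemLp E 2 (spaceTime d T))
    (hB : ∀ i j, MemLp (fun p => B p i j) 2 (spaceTime d T)) (hw : WeakConstraint T E B) :
    IsHolderHalfWeakStar T B := by
  have hn : ∀ ψ, ‖leray d (divLp d ψ)‖ ≤ (d : ℝ) ^ 2 * c1Norm ψ := fun ψ =>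
    (norm_leray_le _).trans (norm_divLp_le ψ)
  -- The representative is defined for every `t` through `E` alone; `B` enters only in the a.e.
  -- identification.
  refine ⟨fun t => ((fluxCLM hE (Ici t)).comp (leray d)).toLinearMap ∘ₗ divLp d,
    fun t _ => ⟨√(∫ p, ‖E p‖ ^ 2 ∂(spaceTime d T)) *
      √((volume.restrict (Icc 0 T)).real (Ici t)) * (d : ℝ) ^ 2, fun ψ => ?_⟩, ?_,
    √(∫ p, ‖E p‖ ^ 2 ∂(spaceTime d T)) * (d : ℝ) ^ 2, fun ψ s _ t _ => ?_⟩
  · refine (abs_flux_le hE (Ici t) (leray d (divLp d ψ))).trans ?_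
    rw [mul_assoc _ ((d : ℝ) ^ 2)]
    exact mul_le_mul_of_nonneg_left (hn ψ) (by positivity)
  · filter_upwards [ae_evolution hE hB hw] with t ht ψ
    exact (ht ψ.1 ψ.2.1 ψ.2.2).symm
  · refine (abs_flux_sub_flux_le hE s t (leray d (divLp d ψ))).trans ?_
    calc _ ≤ √(∫ p, ‖E p‖ ^ 2 ∂(spaceTime d T)) * √|t - s| * ((d : ℝ) ^ 2 * c1Norm ψ) :=
          mul_le_mul_of_nonneg_left (hn ψ) (by positivity)
      _ = _ := by ring

end EulerDual

/-! ### Nonnegative matrices and the dual form of `K`. -/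

namespace EulerDual
variable {d : ℕ} {T : ℝ} {E : ℝ × Torus d → Vec d} {B : ℝ × Torus d → Mat d}

theorem posSemidef_of_sum_nonneg {A : Mat d} (hA : A.IsSymm)
    (h : ∀ v : Fin d → ℝ, 0 ≤ ∑ i, ∑ j, A i j * (v i * v j)) : A.PosSemidef := by
  refine Matrix.PosSemidef.of_dotProduct_mulVec_nonneg ?_ fun v => ?_
  · exact (Matrix.conjTranspose_eq_transpose_of_trivial A).trans hA
  · refine (h v).trans_eq ?_
    simp only [dotProduct, Matrix.mulVec, Pi.star_apply, star_trivial, Finset.mul_sum]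
    exact Finset.sum_congr rfl fun i _ => Finset.sum_congr rfl fun j _ => by ring

theorem posSemidef_sum_eq_sq {A : Mat d} (hA : A.PosSemidef) :
    ∃ (m : ℕ) (C : Fin m → Fin d → ℝ), ∀ i j, A i j = ∑ k, C k i * C k j := by
  obtain ⟨m, C, hC⟩ := Matrix.posSemidef_iff_eq_sum_vecMulVec.1 hA
  exact ⟨m, C, fun i j => by rw [hC]; simp [Matrix.sum_apply, Matrix.vecMulVec_apply]⟩

/-- Write `A` as a sum of `C_k ⊗ C_k` and apply Cauchy-Schwarz to each `C_k · v`. -/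
theorem posSemidef_quadratic_le {A : Mat d} (hA : A.PosSemidef) (v : Fin d → ℝ) :
    ∑ i, ∑ j, A i j * (v i * v j) ≤ (∑ i, A i i) * ∑ i, v i ^ 2 := by
  obtain ⟨m, C, hC⟩ := posSemidef_sum_eq_sq hA
  have h1 : ∑ i, ∑ j, A i j * (v i * v j) = ∑ k, (∑ i, C k i * v i) ^ 2 := by
    simp only [hC, sq, Finset.sum_mul]
    calc _ = ∑ i, ∑ k, ∑ j, C k i * C k j * (v i * v j) :=
          Finset.sum_congr rfl fun i _ => Finset.sum_comm
      _ = ∑ k, ∑ i, ∑ j, C k i * C k j * (v i * v j) := Finset.sum_comm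
      _ = _ := Finset.sum_congr rfl fun k _ => Finset.sum_congr rfl fun i _ => by
        rw [Finset.mul_sum]
        exact Finset.sum_congr rfl fun j _ => by ring
  have h2 : (∑ i, A i i) * ∑ i, v i ^ 2 = ∑ k, (∑ i, C k i ^ 2) * ∑ i, v i ^ 2 := by
    rw [← Finset.sum_mul, Finset.sum_comm]
    simp only [hC, sq]
  rw [h1, h2]
  exact Finset.sum_le_sum fun k _ => Finset.sum_mul_sq_le_sq_mul_sq _ _ _

theorem posSemidef_abs_apply_le {A : Mat d} (hA : A.PosSemidef) (i j : Fin d) :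
    |A i j| ≤ ∑ i, A i i := by
  obtain ⟨m, C, hC⟩ := posSemidef_sum_eq_sq hA
  have hd : ∀ i, A i i ≤ ∑ i, A i i := fun i =>
    Finset.single_le_sum (f := fun i => A i i) (fun i _ => hA.diag_nonneg) (Finset.mem_univ i)
  have h1 : |A i j| ≤ (A i i + A j j) / 2 := by
    rw [hC, hC, hC, ← Finset.sum_add_distrib, Finset.sum_div]
    refine (Finset.abs_sum_le_sum_abs _ _).trans (Finset.sum_le_sum fun k _ => ?_)
    rw [abs_le]
    constructor <;> nlinarith [sq_nonneg (C k i + C k j), sq_nonneg (C k i - C k j)]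
  linarith [hd i, hd j]

/-- On an eigenvector for `r` the quadratic form of `I + 2A` is `(1 + 2r)|v|²`, which lies between
`0` and `d|v|²` because the trace of `I + 2A` is `d`. -/
theorem spectrum_subset_of_posSemidef {A : Mat d} (hA : (1 + (2 : ℝ) • A).PosSemidef)
    (htr : ∑ i, A i i = 0) : spectrum ℝ A ⊆ Icc (-1 / 2 : ℝ) (((d : ℝ) - 1) / 2) := by
  intro r hr
  rw [← Matrix.spectrum_toLin', ← Module.End.hasEigenvalue_iff_mem_spectrum] at hr
  obtain ⟨v, hv⟩ := hr.exists_hasEigenvector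
  have h1 : A.mulVec v = r • v := by simpa using hv.apply_eq_smul
  have hq : ∑ i, ∑ j, (1 + (2 : ℝ) • A) i j * (v i * v j) = (1 + 2 * r) * ∑ i, v i ^ 2 := by
    have : ∀ i, ∑ j, A i j * v j = r * v i := fun i => by
      simpa [Matrix.mulVec, dotProduct] using congrFun h1 i
    have h2 : ∀ i, ∑ j, (1 + (2 : ℝ) • A) i j * (v i * v j) = (1 + 2 * r) * v i ^ 2 := by
      intro i
      have e : ∀ j, (1 + (2 : ℝ) • A) i j * (v i * v j) =
          (if i = j then v i * v j else 0) + 2 * v i * (A i j * v j) := by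
        intro j
        simp only [Matrix.add_apply, Matrix.one_apply, Matrix.smul_apply, smul_eq_mul]
        split_ifs <;> ring
      simp only [e, Finset.sum_add_distrib, ← Finset.mul_sum, this, Finset.sum_ite_eq,
        Finset.mem_univ, if_true]
      ring
    rw [Finset.mul_sum]
    exact Finset.sum_congr rfl fun i _ => h2 i
  have hpos : 0 < ∑ i, v i ^ 2 := by
    obtain ⟨i, hi⟩ := Function.ne_iff.1 hv.2
    exact Finset.sum_pos' (fun i _ => sq_nonneg _) ⟨i, Finset.mem_univ i, by
      have : v i ≠ 0 := hi
      positivity⟩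
  have hlow : 0 ≤ ∑ i, ∑ j, (1 + (2 : ℝ) • A) i j * (v i * v j) := by
    refine (hA.dotProduct_mulVec_nonneg v).trans_eq ?_
    simp only [dotProduct, Matrix.mulVec, Pi.star_apply, star_trivial, Finset.mul_sum]
    exact Finset.sum_congr rfl fun i _ => Finset.sum_congr rfl fun j _ => by ring
  have hup := posSemidef_quadratic_le hA v
  have htr' : ∑ i, (1 + (2 : ℝ) • A) i i = d := by
    simp only [Matrix.add_apply, Matrix.one_apply_eq, Matrix.smul_apply, smul_eq_mul,
      Finset.sum_add_distrib, ← Finset.mul_sum, htr]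
    simp
  rw [hq] at hlow
  rw [hq, htr'] at hup
  have h3 : 0 ≤ 1 + 2 * r := nonneg_of_mul_nonneg_left hlow hpos
  have h4 : 1 + 2 * r ≤ d := le_of_mul_le_mul_right hup hpos
  constructor <;> linarith

/-- The integral whose supremum over the dual pairs `(Z,M)` is `K[E,B]`. -/
def dualValue (T : ℝ) (E : ℝ × Torus d → Vec d) (B : ℝ × Torus d → Mat d)
    (Z : ℝ × Torus d → Vec d) (M : ℝ × Torus d → Mat d) : ℝ :=
  (1 / 2 : ℝ) * ∫ p, (2 * (∑ i, E p i * Z p i)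
    - ∑ i, ∑ j, ((1 : Mat d) i j + 2 * B p i j) * M p i j) ∂(spaceTime d T)

theorem K_le_iff (E : ℝ × Torus d → Vec d) (B : ℝ × Torus d → Mat d) (c : ℝ) :
    K T E B ≤ (c : EReal) ↔ ∀ Z M, IsDualPair T Z M → dualValue T E B Z M ≤ c := by
  simp only [K, iSup_le_iff, EReal.coe_le_coe_iff]
  rfl

/-- This replaces the extended-real objective by a family of real inequalities; on square integrable
pairs each is affine in `(E,B)`, whence the convexity and closedness of superlevel sets. -/
theorem le_objective_iff (P₀ : Torus d → Vec d) (E : ℝ × Torus d → Vec d)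
    (B : ℝ × Torus d → Mat d) (c : ℝ) :
    (c : EReal) ≤ objective T P₀ E B ↔ ∀ Z M, IsDualPair T Z M →
      dualValue T E B Z M ≤ -(∫ p, ∑ i, P₀ p.2 i * E p i ∂(spaceTime d T)) - c := by
  rw [← K_le_iff, objective, EReal.le_sub_iff_add_le (by simp) (by simp), ← EReal.coe_add,
    EReal.le_neg, ← EReal.coe_neg]
  have : -(c + ∫ p, ∑ i, P₀ p.2 i * E p i ∂(spaceTime d T)) =
    -(∫ p, ∑ i, P₀ p.2 i * E p i ∂(spaceTime d T)) - c := by ring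
  rw [this]

theorem isDualPair_vecMulVec {Z : ℝ × Torus d → Vec d} (hZ : Continuous Z) :
    IsDualPair T Z fun p => Matrix.vecMulVec (fun i => Z p i) (fun i => Z p i) where
  continuousOn_Z := hZ.continuousOn
  continuousOn_M := by
    have : Continuous fun p => Matrix.vecMulVec (fun i => Z p i) (fun i => Z p i) := by
      have h : ∀ i, Continuous fun p => Z p i := fun i => by fun_prop
      exact continuous_matrix fun i j => by
        simp only [Matrix.vecMulVec_apply]
        exact (h i).mul (h j)
    exact this.continuousOn
  symm_M p _ := by
    ext i j
    simp [Matrix.vecMulVec_apply, mul_comm]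
  le_M p _ := by
    rw [sub_self]
    exact Matrix.PosSemidef.zero

theorem isDualPair_zero_smul {φ : ℝ × Torus d → ℝ} (hφ : Continuous φ) (h0 : ∀ p, 0 ≤ φ p)
    (v : Fin d → ℝ) : IsDualPair T 0 fun p => φ p • Matrix.vecMulVec v v where
  continuousOn_Z := continuousOn_const
  continuousOn_M := (hφ.smul continuous_const).continuousOn
  symm_M p _ := by
    ext i j
    simp [Matrix.vecMulVec_apply, mul_comm]
  le_M p _ := by
    have h1 : Matrix.vecMulVec (fun i => (0 : ℝ × Torus d → Vec d) p i)
        (fun i => (0 : ℝ × Torus d → Vec d) p i) = 0 := by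
      ext i j
      simp [Matrix.vecMulVec_apply]
    rw [h1, sub_zero]
    have h2 := Matrix.posSemidef_vecMulVec_self_star v
    rw [star_trivial] at h2
    exact h2.smul (h0 p)

/-- An `L²` function with nonnegative integral against all nonnegative continuous functions is
nonnegative. -/
theorem ae_nonneg_of_integral_mul_nonneg {α : Type*} [TopologicalSpace α] [MeasurableSpace α]
    [BorelSpace α] [NormalSpace α] [SecondCountableTopologyEither α ℝ] {μ : Measure α}
    [IsFiniteMeasure μ] [μ.WeaklyRegular] {g : α → ℝ} (hg : MemLp g 2 μ)
    (h : ∀ φ : α → ℝ, Continuous φ → (∀ x, 0 ≤ φ x) → 0 ≤ ∫ x, φ x * g x ∂μ) :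
    ∀ᵐ x ∂μ, 0 ≤ g x := by
  have key : ∀ u : Lp ℝ 2 μ, 0 ≤ (inner ℝ (hg.toLp g) (Lp.posPart u) : ℝ) := by
    intro u
    refine (BoundedContinuousFunction.toLp_denseRange (p := 2) ℝ μ ℝ
      ENNReal.ofNat_ne_top).induction_on (p := fun u => 0 ≤ (inner ℝ (hg.toLp g) (Lp.posPart u) : ℝ))
      u ?_ fun f => ?_
    · exact isClosed_le continuous_const (continuous_const.inner Lp.continuous_posPart)
    · rw [L2.inner_def]
      refine (h (fun x => max (f x) 0) (f.continuous.max continuous_const)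
        fun x => le_max_right _ _).trans_eq (integral_congr_ae ?_)
      filter_upwards [hg.coeFn_toLp, BoundedContinuousFunction.coeFn_toLp (p := 2) μ ℝ f,
        Lp.coeFn_posPart (BoundedContinuousFunction.toLp 2 μ ℝ f)] with x h1 h2 h3
      rw [h1, h3, h2]
      simp
  -- Density and continuity of the positive part allow the negative part of `g` itself as test
  -- function, which gives `-∫ (g⁻)² ≥ 0`.
  have h1 := key (-(hg.toLp g))
  rw [L2.inner_def] at h1
  have h2 : ∫ x, max (-g x) 0 ^ 2 ∂μ ≤ 0 := by
    rw [← neg_nonneg, ← integral_neg]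
    refine h1.trans_eq (integral_congr_ae ?_)
    filter_upwards [hg.coeFn_toLp, Lp.coeFn_neg (hg.toLp g), Lp.coeFn_posPart (-(hg.toLp g))]
      with x h1 h2 h3
    rw [h3, h2, Pi.neg_apply, h1]
    rcases le_total (g x) 0 with h | h <;> simp [h, sq]
  have hm : MemLp (fun x => max (-g x) 0) 2 μ := hg.neg.pos_part
  have h3 := (integral_eq_zero_iff_of_nonneg (fun x => sq_nonneg (max (-g x) 0)) hm.integrable_sq).1
    (le_antisymm h2 (integral_nonneg fun x => sq_nonneg _))
  filter_upwards [h3] with x hx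
  have := (pow_eq_zero_iff two_ne_zero).1 hx
  have h4 := max_eq_right_iff.1 this
  linarith

end EulerDual

/-! ### A priori estimates from a bound on `K`. -/

namespace EulerDual
variable {d : ℕ} {T : ℝ} {E : ℝ × Torus d → Vec d} {B : ℝ × Torus d → Mat d}

/-- The analogue of `MemEB` with `B` only square integrable. -/
structure MemEBTwo (T : ℝ) (E : ℝ × Torus d → Vec d) (B : ℝ × Torus d → Mat d) : Prop where
  memLp_E : MemLp E 2 (spaceTime d T)
  memLp_B : ∀ i j, MemLp (fun p => B p i j) 2 (spaceTime d T)
  symm_B : ∀ᵐ p ∂(spaceTime d T), (B p).IsSymm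
  weak : WeakConstraint T E B

theorem MemEB.memEBTwo (h : MemEB T E B) : MemEBTwo T E B :=
  ⟨h.memLp_E, fun i j => (h.memLp_B i j).mono_exponent le_top, h.symm_B, h.weak⟩

theorem MemEBTwo.memLp_coeff (h : MemEBTwo T E B) (i j : Fin d) :
    MemLp (fun p => (1 : Mat d) i j + 2 * B p i j) 2 (spaceTime d T) := by
  generalize (1 : Mat d) i j = c
  have h1 : MemLp (fun _ : ℝ × Torus d => c) 2 (spaceTime d T) := memLp_const c
  exact h1.add ((h.memLp_B i j).const_mul 2)

/-- The admissible `M` form a cone when `Z = 0`: a negative integral could be scaled until the dual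
value exceeds `C`. -/
theorem MemEBTwo.ae_quadratic_nonneg (h : MemEBTwo T E B) {C : ℝ}
    (hK : ∀ Z M, IsDualPair T Z M → dualValue T E B Z M ≤ C) (v : Fin d → ℝ) :
    ∀ᵐ p ∂(spaceTime d T), 0 ≤ ∑ i, ∑ j, ((1 : Mat d) i j + 2 * B p i j) * (v i * v j) := by
  refine ae_nonneg_of_integral_mul_nonneg (memLp_finsetSum _ fun i _ => memLp_finsetSum _ fun j _ =>
    (h.memLp_coeff i j).mul_const _) fun φ hφ hφ0 => ?_
  set I := ∫ p, φ p * ∑ i, ∑ j, ((1 : Mat d) i j + 2 * B p i j) * (v i * v j) ∂(spaceTime d T)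
    with hI
  have hval : ∀ l : ℝ, 0 ≤ l → -(l / 2) * I ≤ C := by
    intro l hl
    refine (hK 0 _ (isDualPair_zero_smul (φ := fun p => l * φ p) (continuous_const.mul hφ)
      (fun p => mul_nonneg hl (hφ0 p)) v)).trans' (le_of_eq ?_)
    have e : ∀ p, (2 * (∑ i, E p i * (0 : ℝ × Torus d → Vec d) p i)
        - ∑ i, ∑ j, ((1 : Mat d) i j + 2 * B p i j) *
          ((l * φ p) • Matrix.vecMulVec v v) i j) =
        -l * (φ p * ∑ i, ∑ j, ((1 : Mat d) i j + 2 * B p i j) * (v i * v j)) := by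
      intro p
      simp only [Pi.zero_apply, PiLp.zero_apply, mul_zero, Finset.sum_const_zero, zero_sub,
        Matrix.smul_apply, Matrix.vecMulVec_apply, smul_eq_mul, Finset.mul_sum]
      rw [← Finset.sum_neg_distrib]
      refine Finset.sum_congr rfl fun i _ => ?_
      rw [← Finset.sum_neg_distrib]
      exact Finset.sum_congr rfl fun j _ => by ring
    simp only [dualValue, e]
    rw [integral_const_mul, ← hI]
    ring
  by_contra! hneg
  -- This `l` makes the dual value equal to `|C| + 1 > C`.
  have := hval (2 * (|C| + 1) / (-I)) (div_nonneg (by positivity) (by linarith))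
  have h2 : -(2 * (|C| + 1) / (-I) / 2) * I = |C| + 1 := by
    have := hneg.ne
    field_simp
  rw [h2] at this
  linarith [le_abs_self C]

theorem MemEBTwo.ae_posSemidef (h : MemEBTwo T E B) {C : ℝ}
    (hK : ∀ Z M, IsDualPair T Z M → dualValue T E B Z M ≤ C) :
    ∀ᵐ p ∂(spaceTime d T), (1 + (2 : ℝ) • B p).PosSemidef := by
  -- The null set depends on `v`, so only a countable dense set of vectors is tested; continuity of
  -- the quadratic form gives the rest.
  filter_upwards [h.symm_B, ae_all_iff.2 fun n => h.ae_quadratic_nonneg hK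
    (TopologicalSpace.denseSeq (Fin d → ℝ) n)] with p hs hp
  refine posSemidef_of_sum_nonneg (Matrix.isSymm_one.add (hs.smul _)) fun v => ?_
  refine (TopologicalSpace.denseRange_denseSeq (Fin d → ℝ)).induction_on (p := fun v : Fin d → ℝ =>
    0 ≤ ∑ i, ∑ j, (1 + (2 : ℝ) • B p) i j * (v i * v j)) v ?_ fun n => hp n
  exact isClosed_le continuous_const (by fun_prop)

theorem MemEBTwo.ae_trace (h : MemEBTwo T E B) : ∀ᵐ p ∂(spaceTime d T), ∑ i, B p i i = 0 :=
  ae_trace_eq_zero h.memLp_E h.memLp_B h.weak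

theorem trace_one_add_two_smul {A : Mat d} (htr : ∑ i, A i i = 0) :
    ∑ i, (1 + (2 : ℝ) • A) i i = d := by
  simp only [Matrix.add_apply, Matrix.one_apply_eq, Matrix.smul_apply, smul_eq_mul,
    Finset.sum_add_distrib, ← Finset.mul_sum, htr]
  simp

theorem MemEBTwo.ae_abs_le (h : MemEBTwo T E B) {C : ℝ}
    (hK : ∀ Z M, IsDualPair T Z M → dualValue T E B Z M ≤ C) :
    ∀ᵐ p ∂(spaceTime d T), ∀ i j, |B p i j| ≤ ((d : ℝ) + 1) / 2 := by
  filter_upwards [h.ae_posSemidef hK, h.ae_trace] with p hp htr i j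
  have h1 := posSemidef_abs_apply_le hp i j
  rw [trace_one_add_two_smul htr, Matrix.add_apply, Matrix.smul_apply, smul_eq_mul] at h1
  have h2 : |(1 : Mat d) i j| ≤ 1 := by
    rw [Matrix.one_apply]
    split_ifs <;> simp
  rw [abs_le]
  rw [abs_le] at h1 h2
  constructor <;> linarith

theorem MemEBTwo.memEB (h : MemEBTwo T E B) {C : ℝ}
    (hK : ∀ Z M, IsDualPair T Z M → dualValue T E B Z M ≤ C) : MemEB T E B := by
  refine ⟨h.memLp_E, fun i j => ?_, h.symm_B, h.weak⟩
  refine memLp_top_of_bound (h.memLp_B i j).aestronglyMeasurable (((d : ℝ) + 1) / 2) ?_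
  filter_upwards [h.ae_abs_le hK] with p hp using hp i j

/-- Take `M = Z ⊗ Z` and use `I + 2B ≤ d I`. -/
theorem MemEBTwo.le_dualValue (h : MemEBTwo T E B) {C : ℝ}
    (hK : ∀ Z M, IsDualPair T Z M → dualValue T E B Z M ≤ C)
    (Z : BoundedContinuousFunction (ℝ × Torus d) (Vec d)) :
    (inner ℝ (h.memLp_E.toLp E) (BoundedContinuousFunction.toLp 2 (spaceTime d T) ℝ Z) : ℝ) -
      (d : ℝ) / 2 * ‖BoundedContinuousFunction.toLp 2 (spaceTime d T) ℝ Z‖ ^ 2 ≤ C := by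
  have hZ : MemLp Z 2 (spaceTime d T) :=
    MemLp.of_bound Z.continuous.aestronglyMeasurable ‖Z‖
      (Filter.Eventually.of_forall Z.norm_coe_le_norm)
  have e : BoundedContinuousFunction.toLp 2 (spaceTime d T) ℝ Z = hZ.toLp Z := rfl
  rw [e, inner_toLp, norm_toLp_sq]
  refine (hK Z _ (isDualPair_vecMulVec Z.continuous)).trans' ?_
  have i1 := integrable_inner_of_memLp h.memLp_E hZ
  have i2 : Integrable (fun p => ‖Z p‖ ^ 2) (spaceTime d T) := hZ.integrable_norm_pow two_ne_zero
  have hZi : ∀ i p, |Z p i| ≤ ‖Z‖ := fun i p => (PiLp.norm_apply_le (Z p) i).trans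
    (Z.norm_coe_le_norm p)
  have hZc : ∀ i, Continuous fun p => Z p i := fun i => by
    have := Z.continuous
    fun_prop
  have hZZ : ∀ i j, MemLp (fun p => Z p i * Z p j) 2 (spaceTime d T) := fun i j =>
    MemLp.of_bound ((hZc i).mul (hZc j)).aestronglyMeasurable (‖Z‖ * ‖Z‖)
      (Filter.Eventually.of_forall fun p => by
        rw [norm_mul]
        exact mul_le_mul (hZi i p) (hZi j p) (abs_nonneg _) (norm_nonneg _))
  have i3 : Integrable (fun p => ∑ i, ∑ j, ((1 : Mat d) i j + 2 * B p i j) * (Z p i * Z p j))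
      (spaceTime d T) :=
    integrable_finsetSum _ fun i _ => integrable_finsetSum _ fun j _ =>
      (h.memLp_coeff i j).integrable_mul (hZZ i j)
  have e2 : dualValue T E B Z (fun p => Matrix.vecMulVec (fun i => Z p i) (fun i => Z p i)) =
      (1 / 2 : ℝ) * ∫ p, (2 * inner ℝ (E p) (Z p) -
        ∑ i, ∑ j, ((1 : Mat d) i j + 2 * B p i j) * (Z p i * Z p j)) ∂(spaceTime d T) := by
    simp only [dualValue, vec_inner_eq_sum, Matrix.vecMulVec_apply]
  have e3 : (∫ p, inner ℝ (E p) (Z p) ∂(spaceTime d T)) -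
      (d : ℝ) / 2 * ∫ p, ‖Z p‖ ^ 2 ∂(spaceTime d T) =
      (1 / 2 : ℝ) * ∫ p, (2 * inner ℝ (E p) (Z p) - d * ‖Z p‖ ^ 2) ∂(spaceTime d T) := by
    rw [integral_sub (i1.const_mul 2) (i2.const_mul _), integral_const_mul, integral_const_mul]
    ring
  rw [e2, e3]
  refine mul_le_mul_of_nonneg_left (integral_mono_ae ((i1.const_mul 2).sub (i2.const_mul _))
    ((i1.const_mul 2).sub i3) ?_) (by norm_num)
  filter_upwards [h.ae_posSemidef hK, h.ae_trace] with p hp htr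
  have h1 := posSemidef_quadratic_le hp (fun i => Z p i)
  rw [trace_one_add_two_smul htr] at h1
  have h2 : ‖Z p‖ ^ 2 = ∑ i, Z p i ^ 2 := by
    rw [EuclideanSpace.norm_sq_eq]
    simp
  rw [h2]
  exact sub_le_sub_left h1 _

theorem MemEBTwo.integral_norm_sq_le (h : MemEBTwo T E B) (hd : 1 ≤ d) {C : ℝ}
    (hK : ∀ Z M, IsDualPair T Z M → dualValue T E B Z M ≤ C) :
    ∫ p, ‖E p‖ ^ 2 ∂(spaceTime d T) ≤ 2 * d * C := by
  have key : ∀ u : Lp (Vec d) 2 (spaceTime d T),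
      (inner ℝ (h.memLp_E.toLp E) u : ℝ) - (d : ℝ) / 2 * ‖u‖ ^ 2 ≤ C := by
    intro u
    refine (BoundedContinuousFunction.toLp_denseRange (p := 2) (Vec d) (spaceTime d T) ℝ
      ENNReal.ofNat_ne_top).induction_on (p := fun u => (inner ℝ (h.memLp_E.toLp E) u : ℝ) -
        (d : ℝ) / 2 * ‖u‖ ^ 2 ≤ C) u ?_ fun Z => h.le_dualValue hK Z
    exact isClosed_le ((continuous_const.inner continuous_id).sub
      (continuous_const.mul (continuous_norm.pow 2))) continuous_const
  have hd' : (0 : ℝ) < d := by exact_mod_cast hd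
  -- `E/d` maximizes the concave quadratic `⟨E,u⟩ - (d/2)‖u‖²`; it is reached through density of the
  -- continuous fields.
  have h1 := key ((1 / (d : ℝ)) • h.memLp_E.toLp E)
  rw [inner_smul_right, real_inner_self_eq_norm_sq, norm_smul, Real.norm_of_nonneg (by positivity),
    norm_toLp_sq] at h1
  rw [mul_pow, norm_toLp_sq] at h1
  have h2 : ∀ x : ℝ, 1 / (d : ℝ) * x - d / 2 * ((1 / d) ^ 2 * x) = x / (2 * d) := by
    intro x
    field_simp
    ring
  rw [h2, div_le_iff₀ (by positivity)] at h1
  linarith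

theorem abs_integral_initial_le (hT : 0 < T) {P₀ : Torus d → Vec d} (hP₀ : MemLp P₀ 2 volume)
    (hE : MemLp E 2 (spaceTime d T)) :
    |∫ p, ∑ i, P₀ p.2 i * E p i ∂(spaceTime d T)| ≤
      √(T * ∫ x, ‖P₀ x‖ ^ 2) * √(∫ p, ‖E p‖ ^ 2 ∂(spaceTime d T)) := by
  have h := abs_integral_inner_le (memLp_comp_snd (T := T) hP₀) hE
  have h2 := integral_comp_snd_spaceTime (T := T) (fun x => ‖P₀ x‖ ^ 2) univ
  simp only [univ_prod_univ, Measure.restrict_univ] at h2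
  rw [h2] at h
  simp only [vec_inner_eq_sum] at h
  have h3 : (volume.restrict (Icc 0 T)).real univ = T := by simp [hT.le]
  rwa [h3] at h

theorem MemEBTwo.energy_estimate (h : MemEBTwo T E B) (hd : 1 ≤ d) (hT : 0 < T)
    {P₀ : Torus d → Vec d} (hP₀ : MemLp P₀ 2 volume) {c : ℝ}
    (hc : (c : EReal) ≤ objective T P₀ E B) :
    ∫ p, ‖E p‖ ^ 2 ∂(spaceTime d T) ≤
      2 * d * (√(T * ∫ x, ‖P₀ x‖ ^ 2) * √(∫ p, ‖E p‖ ^ 2 ∂(spaceTime d T)) - c) := by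
  refine (h.integral_norm_sq_le hd ((le_objective_iff P₀ E B c).1 hc)).trans ?_
  have := (abs_le.1 (abs_integral_initial_le hT hP₀ h.memLp_E)).1
  gcongr
  linarith

theorem zero_memEB (d : ℕ) (T : ℝ) : MemEB (d := d) T 0 0 where
  memLp_E := MemLp.zero
  memLp_B _ _ := MemLp.zero
  symm_B := Filter.Eventually.of_forall fun _ => Matrix.isSymm_zero
  weak := fun ζ ψ θ _ _ _ _ _ => by simp

theorem trace_nonneg_of_isDualPair {Z : ℝ × Torus d → Vec d} {M : ℝ × Torus d → Mat d}
    (h : IsDualPair T Z M) {p : ℝ × Torus d} (hp : p ∈ Icc 0 T ×ˢ (univ : Set (Torus d))) :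
    0 ≤ ∑ i, M p i i := by
  refine Finset.sum_nonneg fun i _ => ?_
  have := (h.le_M p hp).diag_nonneg (i := i)
  simp only [Matrix.sub_apply, Matrix.vecMulVec_apply] at this
  nlinarith [mul_self_nonneg (Z p i)]

theorem ae_mem_spaceTime (d : ℕ) (T : ℝ) :
    ∀ᵐ p ∂(spaceTime d T), p ∈ Icc 0 T ×ˢ (univ : Set (Torus d)) := by
  have : ∀ᵐ t ∂(volume.restrict (Icc (0 : ℝ) T)), t ∈ Icc (0 : ℝ) T :=
    ae_restrict_mem measurableSet_Icc
  filter_upwards [Measure.quasiMeasurePreserving_fst.ae this] with p hp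
  exact ⟨hp, mem_univ _⟩

/-- For the zero pair every dual value is `-½ ∫ tr M`, and `M ≥ Z ⊗ Z` has nonnegative trace. -/
theorem zero_le_objective_zero (P₀ : Torus d → Vec d) : 0 ≤ objective T P₀ 0 0 := by
  rw [← EReal.coe_zero, le_objective_iff]
  intro Z M hZM
  have h : dualValue T (0 : ℝ × Torus d → Vec d) 0 Z M =
      (1 / 2) * -∫ p, ∑ i, M p i i ∂(spaceTime d T) := by
    rw [dualValue, ← integral_neg]
    simp [Matrix.one_apply]
  have h2 : 0 ≤ ∫ p, ∑ i, M p i i ∂(spaceTime d T) := by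
    refine integral_nonneg_of_ae ?_
    filter_upwards [ae_mem_spaceTime d T] with p hp using trace_nonneg_of_isDualPair hZM hp
  rw [h]
  simp only [Pi.zero_apply, PiLp.zero_apply, mul_zero, Finset.sum_const_zero, integral_zero]
  linarith

theorem zero_le_J (T : ℝ) (P₀ : Torus d → Vec d) : 0 ≤ J T P₀ :=
  (zero_le_objective_zero P₀).trans (le_iSup_of_le 0 (le_iSup_of_le 0
    (le_iSup_of_le (zero_memEB d T) le_rfl)))

theorem J_le (hd : 1 ≤ d) (hT : 0 < T) {P₀ : Torus d → Vec d} (hP₀ : MemLp P₀ 2 volume) :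
    J T P₀ ≤ ((T * (d : ℝ) * ∫ x, ‖P₀ x‖ ^ 2 : ℝ) : EReal) := by
  refine iSup_le fun E => iSup_le fun B => iSup_le fun h => ?_
  by_contra! hlt
  obtain ⟨c, hc1, hc2⟩ := EReal.lt_iff_exists_real_btwn.1 hlt
  rw [EReal.coe_lt_coe_iff] at hc1
  have h1 := h.memEBTwo.energy_estimate hd hT hP₀ hc2.le
  set e := √(∫ p, ‖E p‖ ^ 2 ∂(spaceTime d T)) with he
  have h2 : ∫ p, ‖E p‖ ^ 2 ∂(spaceTime d T) = e ^ 2 :=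
    (Real.sq_sqrt (integral_nonneg fun p => sq_nonneg _)).symm
  have hp0 : 0 ≤ ∫ x, ‖P₀ x‖ ^ 2 := integral_nonneg fun x => sq_nonneg _
  set q := √(T * ∫ x, ‖P₀ x‖ ^ 2) with hq
  have h3 : T * ∫ x, ‖P₀ x‖ ^ 2 = q ^ 2 := (Real.sq_sqrt (by positivity)).symm
  have hd' : (0 : ℝ) < d := by exact_mod_cast hd
  rw [h2] at h1
  have h4 : T * d * ∫ x, ‖P₀ x‖ ^ 2 = d * q ^ 2 := by rw [← h3]; ring
  rw [h4] at hc1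
  -- The energy estimate reads `(e - d q)² ≤ d² q² - 2 d c`, whose right side is negative once `c >
  -- d q²`.
  nlinarith [sq_nonneg (e - d * q), mul_pos hd' (sub_pos.2 hc1), sq_nonneg (d * q)]

theorem IsMaximizer.integral_norm_sq_le {P₀ : Torus d → Vec d} (h : IsMaximizer T P₀ E B)
    (hd : 1 ≤ d) (hT : 0 < T) (hP₀ : MemLp P₀ 2 volume) :
    ∫ p, ‖E p‖ ^ 2 ∂(spaceTime d T) ≤ 4 * (d : ℝ) ^ 2 * T * ∫ x, ‖P₀ x‖ ^ 2 := by
  have hc : ((0 : ℝ) : EReal) ≤ objective T P₀ E B := by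
    rw [h.2]
    exact zero_le_J T P₀
  have h1 := h.1.memEBTwo.energy_estimate hd hT hP₀ hc
  set e := √(∫ p, ‖E p‖ ^ 2 ∂(spaceTime d T)) with he
  have h2 : ∫ p, ‖E p‖ ^ 2 ∂(spaceTime d T) = e ^ 2 :=
    (Real.sq_sqrt (integral_nonneg fun p => sq_nonneg _)).symm
  have hp0 : 0 ≤ ∫ x, ‖P₀ x‖ ^ 2 := integral_nonneg fun x => sq_nonneg _
  set q := √(T * ∫ x, ‖P₀ x‖ ^ 2) with hq
  have h3 : T * ∫ x, ‖P₀ x‖ ^ 2 = q ^ 2 := (Real.sq_sqrt (by positivity)).symm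
  have h4 : 4 * (d : ℝ) ^ 2 * T * ∫ x, ‖P₀ x‖ ^ 2 = (2 * d * q) ^ 2 := by
    rw [mul_pow, ← h3]
    ring
  rw [h2] at h1 ⊢
  rw [h4]
  nlinarith [sq_nonneg (e - 2 * d * q)]

theorem IsMaximizer.ae_spectrum_subset {P₀ : Torus d → Vec d} (h : IsMaximizer T P₀ E B) :
    ∀ᵐ p ∂(spaceTime d T), spectrum ℝ (B p) ⊆ Icc (-1 / 2 : ℝ) (((d : ℝ) - 1) / 2) := by
  have hc : ((0 : ℝ) : EReal) ≤ objective T P₀ E B := by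
    rw [h.2]
    exact zero_le_J T P₀
  filter_upwards [h.1.memEBTwo.ae_posSemidef ((le_objective_iff P₀ E B 0).1 hc),
    h.1.memEBTwo.ae_trace] with p hp htr
  exact spectrum_subset_of_posSemidef hp htr

end EulerDual

/-! ### Existence of a maximizer by convexity in a Hilbert space. -/

namespace EulerDual
variable {d : ℕ} {T : ℝ}

/-- A decreasing sequence of nonempty bounded closed convex sets of a Hilbert space has a common
point. -/
theorem exists_forall_mem_of_antitone_convex {H : Type*} [NormedAddCommGroup H]
    [InnerProductSpace ℝ H] [CompleteSpace H] {C : ℕ → Set H} (hC : Antitone C)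
    (hconv : ∀ n, Convex ℝ (C n)) (hclosed : ∀ n, IsClosed (C n)) (hne : ∀ n, (C n).Nonempty)
    {R : ℝ} (hR : ∀ x ∈ C 0, ‖x‖ ≤ R) : ∃ x, ∀ n, x ∈ C n := by
  -- Points of minimal norm replace weak compactness: their squared norms increase and are bounded,
  -- and the variational inequality bounds `‖x m - x n‖²` by the increment, so they form a Cauchy
  -- sequence.
  have hmin : ∀ n, ∃ v ∈ C n, ∀ w ∈ C n, ‖v‖ ^ 2 ≤ inner ℝ v w := by
    intro n
    obtain ⟨v, hv, hvn⟩ := exists_norm_eq_iInf_of_complete_convex (hne n)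
      (hclosed n).isComplete (hconv n) 0
    refine ⟨v, hv, fun w hw => ?_⟩
    have := (norm_eq_iInf_iff_real_inner_le_zero (hconv n) hv).1 hvn w hw
    rw [zero_sub, inner_neg_left, inner_sub_right, real_inner_self_eq_norm_sq] at this
    linarith
  choose x hx hxmin using hmin
  have hdist : ∀ n m, n ≤ m → ‖x m - x n‖ ^ 2 ≤ ‖x m‖ ^ 2 - ‖x n‖ ^ 2 := by
    intro n m hnm
    have := hxmin n (x m) (hC hnm (hx m))
    rw [norm_sub_sq_real, real_inner_comm]
    linarith
  have hmono : Monotone fun n => ‖x n‖ ^ 2 := fun n m hnm => by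
    have := hdist n m hnm
    nlinarith [sq_nonneg ‖x m - x n‖]
  have hbdd : BddAbove (range fun n => ‖x n‖ ^ 2) := by
    refine ⟨R ^ 2, ?_⟩
    rintro _ ⟨n, rfl⟩
    exact pow_le_pow_left₀ (norm_nonneg _) (hR _ (hC (Nat.zero_le n) (hx n))) 2
  have hcauchy : CauchySeq x := by
    have h1 := (tendsto_atTop_ciSup hmono hbdd).cauchySeq
    rw [Metric.cauchySeq_iff'] at h1 ⊢
    intro ε hε
    obtain ⟨N, hN⟩ := h1 (ε ^ 2) (by positivity)
    refine ⟨N, fun n hn => ?_⟩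
    have h2 := hN n hn
    rw [Real.dist_eq, abs_of_nonneg (sub_nonneg.2 (hmono hn))] at h2
    rw [dist_eq_norm]
    exact lt_of_pow_lt_pow_left₀ 2 hε.le ((hdist N n hn).trans_lt h2)
  obtain ⟨l, hl⟩ := cauchySeq_tendsto_of_complete hcauchy
  refine ⟨l, fun n => (hclosed n).mem_of_tendsto hl ?_⟩
  filter_upwards [Filter.eventually_ge_atTop n] with m hm using hC hm (hx m)

/-- A set separated by half-spaces from each point outside it is closed and convex. -/
theorem isClosed_and_convex_of_separated {H : Type*} [NormedAddCommGroup H]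
    [InnerProductSpace ℝ H] {C : Set H}
    (h : ∀ u ∉ C, ∃ (w : H) (a : ℝ), a < inner ℝ w u ∧ ∀ v ∈ C, inner ℝ w v ≤ a) :
    IsClosed C ∧ Convex ℝ C := by
  have e : C = ⋂ (q : {q : H × ℝ // ∀ v ∈ C, inner ℝ q.1 v ≤ q.2}),
      {v | inner ℝ q.1.1 v ≤ q.1.2} := by
    ext u
    simp only [mem_iInter, mem_ofPred_eq]
    refine ⟨fun hu q => q.2 u hu, fun hu => ?_⟩
    by_contra hn
    obtain ⟨w, a, h1, h2⟩ := h u hn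
    exact absurd (hu ⟨(w, a), h2⟩) (not_le.2 h1)
  rw [e]
  refine ⟨isClosed_iInter fun q => isClosed_le (continuous_const.inner continuous_id)
    continuous_const, convex_iInter fun q => ?_⟩
  exact convex_halfSpace_le (innerSL ℝ q.1.1).toLinearMap.isLinear q.1.2

/-- The pairs of a vector and a matrix, as a Euclidean space. -/
abbrev VecMat (d : ℕ) : Type := EuclideanSpace ℝ (Fin d ⊕ Fin d × Fin d)

/-- The Hilbert space `L²([0,T] × D)` of pairs of a vector field and a matrix field. -/
abbrev PairSpace (d : ℕ) (T : ℝ) : Type := Lp (VecMat d) 2 (spaceTime d T)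

/-- The field of pairs `(E,B)`. -/
def pairField (E : ℝ × Torus d → Vec d) (B : ℝ × Torus d → Mat d) (p : ℝ × Torus d) : VecMat d :=
  WithLp.toLp 2 (Sum.elim (fun i => E p i) fun q => B p q.1 q.2)

/-- The vector part of a field of pairs. -/
def vecPart (u : ℝ × Torus d → VecMat d) (p : ℝ × Torus d) : Vec d :=
  WithLp.toLp 2 fun i => u p (Sum.inl i)

/-- The matrix part of a field of pairs. -/
def matPart (u : ℝ × Torus d → VecMat d) (p : ℝ × Torus d) : Mat d :=
  Matrix.of fun i j => u p (Sum.inr (i, j))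

variable {E : ℝ × Torus d → Vec d} {B : ℝ × Torus d → Mat d}

theorem memLp_euclidean {ι α : Type*} [Fintype ι] [MeasurableSpace α] {μ : Measure α}
    {f : α → EuclideanSpace ℝ ι} : MemLp f 2 μ ↔ ∀ i, MemLp (fun x => f x i) 2 μ :=
  memLp_piLp_iff

theorem memLp_pairField (hE : MemLp E 2 (spaceTime d T))
    (hB : ∀ i j, MemLp (fun p => B p i j) 2 (spaceTime d T)) :
    MemLp (pairField E B) 2 (spaceTime d T) := by
  refine memLp_euclidean.2 ?_
  rintro (i | ⟨i, j⟩)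
  · exact memLp_euclidean.1 hE i
  · exact hB i j

theorem memLp_vecPart {u : ℝ × Torus d → VecMat d} (hu : MemLp u 2 (spaceTime d T)) :
    MemLp (vecPart u) 2 (spaceTime d T) :=
  memLp_euclidean.2 fun i => memLp_euclidean.1 hu (Sum.inl i)

theorem memLp_matPart {u : ℝ × Torus d → VecMat d} (hu : MemLp u 2 (spaceTime d T)) (i j : Fin d) :
    MemLp (fun p => matPart u p i j) 2 (spaceTime d T) :=
  memLp_euclidean.1 hu (Sum.inr (i, j))

theorem inner_pairField (Z : ℝ × Torus d → Vec d) (W : ℝ × Torus d → Mat d)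
    (u : ℝ × Torus d → VecMat d) (p : ℝ × Torus d) :
    inner ℝ (pairField Z W p) (u p) =
      (∑ i, vecPart u p i * Z p i) + ∑ i, ∑ j, matPart u p i j * W p i j := by
  rw [PiLp.inner_apply, Fintype.sum_sum_type, Fintype.sum_prod_type]
  rfl

theorem inner_toLp_pairField {Z : ℝ × Torus d → Vec d} {W : ℝ × Torus d → Mat d}
    (h : MemLp (pairField Z W) 2 (spaceTime d T)) (u : PairSpace d T) :
    inner ℝ (h.toLp _) u = ∫ p, ((∑ i, vecPart u p i * Z p i) +
      ∑ i, ∑ j, matPart u p i j * W p i j) ∂(spaceTime d T) := by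
  rw [L2.inner_def]
  refine integral_congr_ae ?_
  filter_upwards [h.coeFn_toLp] with p hp
  rw [hp, inner_pairField]

theorem memLp_of_continuousOn {F : Type*} [NormedAddCommGroup F] [SecondCountableTopology F]
    {f : ℝ × Torus d → F} (hf : ContinuousOn f (Icc 0 T ×ˢ univ)) (q : ENNReal) :
    MemLp f q (spaceTime d T) := by
  have hμ : spaceTime d T = (volume.prod volume).restrict (Icc 0 T ×ˢ univ) := by
    rw [spaceTime, ← Measure.prod_restrict, Measure.restrict_univ]
  obtain ⟨C, hC⟩ := (isCompact_Icc.prod isCompact_univ).exists_bound_of_continuousOn hf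
  refine MemLp.of_bound ?_ C ?_
  · rw [hμ]
    exact hf.aestronglyMeasurable (measurableSet_Icc.prod MeasurableSet.univ)
  · filter_upwards [ae_mem_spaceTime d T] with p hp using hC p hp

/-- The representing vector is `(Z, -M)` and the constant is `½ ∫ tr M`, so each dual pair cuts out
a closed half-space. -/
theorem IsDualPair.exists_dualValue_eq {Z : ℝ × Torus d → Vec d} {M : ℝ × Torus d → Mat d}
    (h : IsDualPair T Z M) : ∃ (w : PairSpace d T) (m : ℝ), ∀ u : PairSpace d T,
      dualValue T (vecPart u) (matPart u) Z M = inner ℝ w u - m := by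
  have hM : ∀ i j, ContinuousOn (fun p => M p i j) (Icc 0 T ×ˢ univ) := fun i j =>
    (continuous_id.matrix_elem i j).comp_continuousOn h.continuousOn_M
  have hw : MemLp (pairField Z fun p => -M p) 2 (spaceTime d T) :=
    memLp_pairField (memLp_of_continuousOn h.continuousOn_Z 2)
      fun i j => memLp_of_continuousOn (hM i j).neg 2
  have ht : Integrable (fun p => ∑ i, M p i i) (spaceTime d T) :=
    integrable_finsetSum _ fun i _ => memLp_one_iff_integrable.1 (memLp_of_continuousOn (hM i i) 1)
  refine ⟨hw.toLp _, (1 / 2) * ∫ p, ∑ i, M p i i ∂(spaceTime d T), fun u => ?_⟩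
  have hi : Integrable (fun p => (∑ i, vecPart u p i * Z p i) +
      ∑ i, ∑ j, matPart u p i j * (-M p) i j) (spaceTime d T) := by
    refine (integrable_inner_of_memLp hw (Lp.memLp u)).congr ?_
    exact Filter.Eventually.of_forall fun p => inner_pairField _ _ _ _
  rw [inner_toLp_pairField, ← integral_const_mul, ← integral_sub hi (ht.const_mul _), dualValue,
    ← integral_const_mul]
  refine integral_congr_ae (Filter.Eventually.of_forall fun p => ?_)
  have e : ∑ i, ∑ j, ((1 : Mat d) i j + 2 * matPart u p i j) * M p i j =
      (∑ i, M p i i) - 2 * ∑ i, ∑ j, matPart u p i j * (-M p) i j := by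
    simp only [add_mul, Finset.sum_add_distrib, Matrix.one_apply, ite_mul, one_mul, zero_mul,
      Finset.sum_ite_eq, Finset.mem_univ, if_true, Matrix.neg_apply, mul_neg,
      Finset.sum_neg_distrib, sub_neg_eq_add, Finset.mul_sum, mul_assoc]
  simp only [e]
  ring

theorem exists_initial_eq {P₀ : Torus d → Vec d} (hP₀ : MemLp P₀ 2 volume) :
    ∃ w : PairSpace d T, ∀ u : PairSpace d T,
      ∫ p, ∑ i, P₀ p.2 i * vecPart u p i ∂(spaceTime d T) = inner ℝ w u := by
  have hw : MemLp (pairField (fun p => P₀ p.2) 0) 2 (spaceTime d T) :=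
    memLp_pairField (memLp_comp_snd hP₀) fun _ _ => MemLp.zero
  refine ⟨hw.toLp _, fun u => ?_⟩
  rw [inner_toLp_pairField]
  refine integral_congr_ae (Filter.Eventually.of_forall fun p => ?_)
  simp [mul_comm]

theorem memLp_time_mul {ζ : ℝ → ℝ} (hζ : Continuous ζ) {f : Torus d → ℝ} (hf : Continuous f) :
    MemLp (fun p : ℝ × Torus d => ζ p.1 * f p.2) 2 (spaceTime d T) :=
  memLp_of_continuousOn
    ((hζ.comp continuous_fst).mul (hf.comp continuous_snd)).continuousOn 2

theorem exists_weak_eq {ζ : ℝ → ℝ} {ψ : Torus d → Mat d} {θ : Torus d → ℝ} (hζ : ContDiff ℝ ∞ ζ)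
    (hψ : ∀ i j, TorusContDiff ∞ (fun x => ψ x i j)) (hθ : TorusContDiff ∞ θ) :
    ∃ w : PairSpace d T, ∀ u : PairSpace d T,
      ∫ p, ((∑ i, ∑ j, matPart u p i j * (deriv ζ p.1 * ψ p.2 i j))
        - ∑ k, vecPart u p k * (ζ p.1 *
            ((∑ j, torusPartial j (fun y => ψ y k j) p.2) + torusPartial k θ p.2)))
        ∂(spaceTime d T) = inner ℝ w u := by
  have hw : MemLp (pairField (fun p => WithLp.toLp 2 fun k => -(ζ p.1 *
      ((∑ j, torusPartial j (fun y => ψ y k j) p.2) + torusPartial k θ p.2)))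
      fun p => Matrix.of fun i j => deriv ζ p.1 * ψ p.2 i j) 2 (spaceTime d T) := by
    refine memLp_pairField (memLp_euclidean.2 fun k => ?_) fun i j => ?_
    · exact (memLp_time_mul hζ.continuous (f := fun x =>
        (∑ j, torusPartial j (fun y => ψ y k j) x) + torusPartial k θ x)
        ((continuous_finsetSum _ fun j _ => (hψ k j).one.continuous_torusPartial j).add
          (hθ.one.continuous_torusPartial k))).neg
    · exact memLp_time_mul (contDiff_infty_iff_deriv.1 hζ).2.continuous (hψ i j).continuous
  refine ⟨hw.toLp _, fun u => ?_⟩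
  rw [inner_toLp_pairField]
  refine integral_congr_ae (Filter.Eventually.of_forall fun p => ?_)
  simp only [mul_neg, Finset.sum_neg_distrib, Matrix.of_apply]
  ring

/-- The fields of `EB` with square integrable `B` on which the objective is at least `c`. -/
def superlevel (T : ℝ) (P₀ : Torus d → Vec d) (c : ℝ) : Set (PairSpace d T) :=
  {u | MemEBTwo T (vecPart u) (matPart u) ∧ (c : EReal) ≤ objective T P₀ (vecPart u) (matPart u)}

/-- The entry `(i,j)` minus the entry `(j,i)` of the matrix part of a pair. -/
def skewEntry (i j : Fin d) : VecMat d →L[ℝ] ℝ :=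
  EuclideanSpace.proj (Sum.inr (i, j)) - EuclideanSpace.proj (Sum.inr (j, i))

theorem ae_isSymm_matPart_iff (u : PairSpace d T) :
    (∀ᵐ p ∂(spaceTime d T), (matPart u p).IsSymm) ↔
      ∀ i j, (skewEntry i j).compLpL 2 (spaceTime d T) u = 0 := by
  have h : ∀ i j, (skewEntry i j).compLpL 2 (spaceTime d T) u = 0 ↔
      ∀ᵐ p ∂(spaceTime d T), matPart u p i j = matPart u p j i := by
    intro i j
    rw [Lp.eq_zero_iff_ae_eq_zero]
    refine Filter.eventually_congr ?_
    filter_upwards [(skewEntry i j).coeFn_compLpL u] with p hp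
    rw [hp, Pi.zero_apply, ← sub_eq_zero (b := matPart u p j i)]
    rfl
  simp only [h, ← ae_all_iff]
  refine Filter.eventually_congr (Filter.Eventually.of_forall fun p => ?_)
  exact ⟨fun hs i j => hs.apply j i, fun hs => Matrix.IsSymm.ext fun i j => hs j i⟩

/-- Essential boundedness of `B` is not a closed condition in `L²`, which is why `superlevel` asks
only for `MemEBTwo`; `MemEBTwo.memEB` restores it afterwards. -/
theorem isClosed_and_convex_superlevel {P₀ : Torus d → Vec d} (hP₀ : MemLp P₀ 2 volume) (c : ℝ) :
    IsClosed (superlevel T P₀ c) ∧ Convex ℝ (superlevel T P₀ c) := by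
  obtain ⟨w₀, hw₀⟩ := exists_initial_eq (T := T) hP₀
  have e : superlevel T P₀ c =
      (⋂ i, ⋂ j, (skewEntry i j).compLpL 2 (spaceTime d T) ⁻¹' {0}) ∩ {u | WeakConstraint T (vecPart u) (matPart u) ∧
          (c : EReal) ≤ objective T P₀ (vecPart u) (matPart u)} := by
    ext u
    simp only [superlevel, mem_ofPred_eq, mem_inter_iff, mem_iInter, mem_preimage,
      mem_singleton_iff, ← ae_isSymm_matPart_iff]
    exact ⟨fun h => ⟨h.1.symm_B, h.1.weak, h.2⟩, fun h => ⟨⟨memLp_vecPart (Lp.memLp u),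
      memLp_matPart (Lp.memLp u), h.1, h.2.1⟩, h.2.2⟩⟩
  have h2 : IsClosed {u : PairSpace d T | WeakConstraint T (vecPart u) (matPart u) ∧
      (c : EReal) ≤ objective T P₀ (vecPart u) (matPart u)} ∧
      Convex ℝ {u : PairSpace d T | WeakConstraint T (vecPart u) (matPart u) ∧
        (c : EReal) ≤ objective T P₀ (vecPart u) (matPart u)} := by
    refine isClosed_and_convex_of_separated fun u hu => ?_
    simp only [mem_ofPred_eq, not_and_or] at hu
    rcases hu with hu | hu
    · simp only [WeakConstraint, not_forall] at hu
      obtain ⟨ζ, ψ, θ, hζ, hζ0, hs, hψ, hθ, hne⟩ := hu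
      obtain ⟨w, hw⟩ := exists_weak_eq (T := T) hζ hψ hθ.1
      rw [hw] at hne
      have hv : ∀ v : PairSpace d T, WeakConstraint T (vecPart v) (matPart v) → inner ℝ w v = 0 :=
        fun v hv => (hw v).symm.trans (hv ζ ψ θ hζ hζ0 hs hψ hθ)
      -- The functional vanishes on all admissible pairs but not at `u`; the sign of its value
      -- decides whether `w` or `-w` separates.
      rcases lt_or_gt_of_ne hne with h | h
      · refine ⟨-w, 0, by rw [inner_neg_left]; linarith, fun v hvC => ?_⟩
        rw [inner_neg_left, hv v hvC.1, neg_zero]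
      · exact ⟨w, 0, h, fun v hvC => (hv v hvC.1).le⟩
    · rw [le_objective_iff] at hu
      push Not at hu
      obtain ⟨Z, M, hZM, hlt⟩ := hu
      obtain ⟨w, m, hw⟩ := hZM.exists_dualValue_eq
      rw [hw, hw₀] at hlt
      refine ⟨w + w₀, m - c, by rw [inner_add_left]; linarith, fun v hvC => ?_⟩
      have := (le_objective_iff P₀ _ _ c).1 hvC.2 Z M hZM
      rw [hw, hw₀] at this
      rw [inner_add_left]
      linarith
  rw [e]
  exact ⟨(isClosed_iInter fun i => isClosed_iInter fun j =>
      isClosed_singleton.preimage (ContinuousLinearMap.continuous _)).inter h2.1,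
    (convex_iInter fun i => convex_iInter fun j => (convex_singleton 0).linear_preimage
      ((skewEntry i j).compLpL 2 (spaceTime d T)).toLinearMap).inter h2.2⟩

theorem weakConstraint_congr {E' : ℝ × Torus d → Vec d} {B' : ℝ × Torus d → Mat d}
    (hE : E =ᵐ[spaceTime d T] E') (hB : B =ᵐ[spaceTime d T] B') (h : WeakConstraint T E B) :
    WeakConstraint T E' B' := by
  intro ζ ψ θ hζ hζ0 hs hψ hθ
  rw [← h ζ ψ θ hζ hζ0 hs hψ hθ]
  refine integral_congr_ae ?_
  filter_upwards [hE, hB] with p h1 h2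
  rw [h1, h2]

theorem objective_congr {E' : ℝ × Torus d → Vec d} {B' : ℝ × Torus d → Mat d}
    (hE : E =ᵐ[spaceTime d T] E') (hB : B =ᵐ[spaceTime d T] B') (P₀ : Torus d → Vec d) :
    objective T P₀ E B = objective T P₀ E' B' := by
  have h1 : K T E B = K T E' B' := by
    refine iSup_congr fun Z => iSup_congr fun M => iSup_congr fun _ => ?_
    congr 2
    refine integral_congr_ae ?_
    filter_upwards [hE, hB] with p h1 h2
    rw [h1, h2]
  have h2 : ∫ p, ∑ i, P₀ p.2 i * E p i ∂(spaceTime d T) =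
      ∫ p, ∑ i, P₀ p.2 i * E' p i ∂(spaceTime d T) := by
    refine integral_congr_ae ?_
    filter_upwards [hE] with p h1
    rw [h1]
  rw [objective, objective, h1, h2]

theorem MemEB.toLp_mem_superlevel (h : MemEB T E B) {P₀ : Torus d → Vec d} {c : ℝ}
    (hc : (c : EReal) ≤ objective T P₀ E B) :
    (memLp_pairField h.memLp_E h.memEBTwo.memLp_B).toLp _ ∈ superlevel T P₀ c := by
  have hm := memLp_pairField h.memLp_E h.memEBTwo.memLp_B
  have hE : E =ᵐ[spaceTime d T] vecPart (hm.toLp _) := by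
    filter_upwards [hm.coeFn_toLp] with p hp
    rw [vecPart, hp]
    rfl
  have hB : B =ᵐ[spaceTime d T] matPart (hm.toLp _) := by
    filter_upwards [hm.coeFn_toLp] with p hp
    rw [matPart, hp]
    rfl
  refine ⟨⟨memLp_vecPart (Lp.memLp _), memLp_matPart (Lp.memLp _), ?_,
    weakConstraint_congr hE hB h.weak⟩, (objective_congr hE hB P₀) ▸ hc⟩
  filter_upwards [hB, h.symm_B] with p h1 h2
  rwa [← h1]

theorem exists_norm_le_of_mem_superlevel (hd : 1 ≤ d) (hT : 0 < T) {P₀ : Torus d → Vec d}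
    (hP₀ : MemLp P₀ 2 volume) (c : ℝ) : ∃ R, ∀ u ∈ superlevel T P₀ c, ‖u‖ ≤ R := by
  set q := √(T * ∫ x, ‖P₀ x‖ ^ 2) with hq
  -- Absorb `2 d q e ≤ e²/2 + 2 d² q²` in `e² ≤ 2d (q e - c)`. `R₂` below comes from the pointwise
  -- bound on the entries of `B`.
  set R₁ : ℝ := 4 * d ^ 2 * q ^ 2 - 4 * d * c with hR₁
  set R₂ : ℝ := ∫ _p, ∑ _i : Fin d, ∑ _j : Fin d, (((d : ℝ) + 1) / 2) ^ 2 ∂(spaceTime d T) with hR₂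
  refine ⟨√(R₁ + R₂), fun u hu => ?_⟩
  refine Real.le_sqrt_of_sq_le ?_
  have h1 := hu.1.energy_estimate hd hT hP₀ hu.2
  set e := √(∫ p, ‖vecPart u p‖ ^ 2 ∂(spaceTime d T)) with he
  have h2 : ∫ p, ‖vecPart u p‖ ^ 2 ∂(spaceTime d T) = e ^ 2 :=
    (Real.sq_sqrt (integral_nonneg fun p => sq_nonneg _)).symm
  rw [h2] at h1
  have h3 : e ^ 2 ≤ R₁ := by
    rw [hR₁]
    nlinarith [sq_nonneg (e - 2 * d * q)]
  have hi : Integrable (fun p => ∑ i, ∑ j, matPart u p i j ^ 2) (spaceTime d T) :=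
    integrable_finsetSum _ fun i _ => integrable_finsetSum _ fun j _ =>
      (memLp_matPart (Lp.memLp u) i j).integrable_sq
  have h4 : ‖u‖ ^ 2 = (∫ p, ‖vecPart u p‖ ^ 2 ∂(spaceTime d T)) +
      ∫ p, ∑ i, ∑ j, matPart u p i j ^ 2 ∂(spaceTime d T) := by
    rw [norm_sq_eq_integral, ← integral_add
      ((memLp_vecPart (Lp.memLp u)).integrable_norm_pow two_ne_zero) hi]
    refine integral_congr_ae (Filter.Eventually.of_forall fun p => ?_)
    simp only [EuclideanSpace.norm_sq_eq, Fintype.sum_sum_type, Fintype.sum_prod_type,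
      Real.norm_eq_abs, sq_abs]
    rfl
  rw [h4, h2]
  refine add_le_add h3 (integral_mono_ae hi (integrable_const _) ?_)
  filter_upwards [hu.1.ae_abs_le ((le_objective_iff P₀ _ _ c).1 hu.2)] with p hp
  refine Finset.sum_le_sum fun i _ => Finset.sum_le_sum fun j _ => ?_
  exact sq_le_sq.2 ((hp i j).trans (le_abs_self _))

theorem exists_isMaximizer (hd : 1 ≤ d) (hT : 0 < T) {P₀ : Torus d → Vec d}
    (hP₀ : MemLp P₀ 2 volume) :
    ∃ (E : ℝ × Torus d → Vec d) (B : ℝ × Torus d → Mat d), IsMaximizer T P₀ E B := by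
  obtain ⟨j, hj⟩ : ∃ j : ℝ, J T P₀ = j :=
    ⟨(J T P₀).toReal, (EReal.coe_toReal (ne_top_of_le_ne_top (EReal.coe_ne_top _)
      (J_le hd hT hP₀)) (ne_bot_of_le_ne_bot EReal.zero_ne_bot (zero_le_J T P₀))).symm⟩
  have hanti : Antitone fun n : ℕ => superlevel T P₀ (j - 1 / ((n : ℝ) + 1)) := by
    intro n m hnm u hu
    refine ⟨hu.1, le_trans ?_ hu.2⟩
    rw [EReal.coe_le_coe_iff]
    exact sub_le_sub_left (one_div_le_one_div_of_le (by positivity) (by gcongr)) j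
  have hne : ∀ n : ℕ, (superlevel T P₀ (j - 1 / ((n : ℝ) + 1))).Nonempty := by
    intro n
    have hlt : ((j - 1 / ((n : ℝ) + 1) : ℝ) : EReal) < J T P₀ := by
      rw [hj, EReal.coe_lt_coe_iff]
      have : (0 : ℝ) < 1 / ((n : ℝ) + 1) := by positivity
      linarith
    simp only [J, lt_iSup_iff] at hlt
    obtain ⟨E, B, h, hlt⟩ := hlt
    exact ⟨_, h.toLp_mem_superlevel hlt.le⟩
  obtain ⟨R, hR⟩ := exists_norm_le_of_mem_superlevel hd hT hP₀ (j - 1 / (((0 : ℕ) : ℝ) + 1))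
  obtain ⟨u, hu⟩ := exists_forall_mem_of_antitone_convex hanti
    (fun n => (isClosed_and_convex_superlevel hP₀ _).2)
    (fun n => (isClosed_and_convex_superlevel hP₀ _).1) hne hR
  have hmem : MemEB T (vecPart u) (matPart u) :=
    (hu 0).1.memEB ((le_objective_iff P₀ _ _ _).1 (hu 0).2)
  refine ⟨vecPart u, matPart u, hmem, le_antisymm
    (le_iSup_of_le _ (le_iSup_of_le _ (le_iSup_of_le hmem le_rfl))) ?_⟩
  rw [hj, le_objective_iff]
  intro Z M hZM
  -- `u` lies in every superlevel set, so each dual inequality holds with loss `1/(n+1)` for all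
  -- `n`, hence without loss.
  refine le_of_forall_pos_le_add fun ε hε => ?_
  obtain ⟨n, hn⟩ := exists_nat_one_div_lt hε
  have := (le_objective_iff P₀ _ _ _).1 (hu n).2 Z M hZM
  linarith

end EulerDual

end

theorem theorem1 (d : ℕ) (hd : 1 ≤ d) (T : ℝ) (hT : 0 < T)
    (P₀ : EulerDual.Torus d → EulerDual.Vec d)
    (hP₀ : MemLp P₀ 2 volume) (hdiv : EulerDual.IsDivFree P₀) (hmean : ∫ x, P₀ x = 0) :
    (∃ (E : ℝ × EulerDual.Torus d → EulerDual.Vec d) (B : ℝ × EulerDual.Torus d → EulerDual.Mat d),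
      EulerDual.IsMaximizer T P₀ E B) ∧
    (∀ (E : ℝ × EulerDual.Torus d → EulerDual.Vec d) (B : ℝ × EulerDual.Torus d → EulerDual.Mat d),
      EulerDual.IsMaximizer T P₀ E B →
        (∀ᵐ p ∂(EulerDual.spaceTime d T),
          spectrum ℝ (B p) ⊆ Icc (-1 / 2 : ℝ) (((d : ℝ) - 1) / 2)) ∧
        (∫ p, ‖E p‖ ^ 2 ∂(EulerDual.spaceTime d T)) ≤ 4 * (d : ℝ) ^ 2 * T * ∫ x, ‖P₀ x‖ ^ 2 ∧
        EulerDual.IsHolderHalfWeakStar T B) ∧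
    0 ≤ EulerDual.J T P₀ ∧
    EulerDual.J T P₀ ≤ ((T * (d : ℝ) * ∫ x, ‖P₀ x‖ ^ 2 : ℝ) : EReal) :=
  ⟨EulerDual.exists_isMaximizer hd hT hP₀, fun _ _ h => ⟨h.ae_spectrum_subset,
    h.integral_norm_sq_le hd hT hP₀, EulerDual.isHolderHalfWeakStar h.1.memEBTwo.memLp_E
      h.1.memEBTwo.memLp_B h.1.memEBTwo.weak⟩, EulerDual.zero_le_J T P₀, EulerDual.J_le hd hT hP₀⟩
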